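/- **Lemma 4.2 (Absorbing Lemma).** Let $H$ be a $k$-graph ($k\ge 2$) with vertex set $V$, $|V|=n$. For $W\subseteq V$, $H[W]$ has a *perfect matching* if $W$ is the union of pairwise disjoint edges of $H$. A set $T\subseteq V$ *absorbs* a set $S\subseteq V$ if both $H[T]$ and $H[T\cup S]$ have perfect matchings. Vertices $u,v$ are *$(\beta,t)$-reachable* in $H$ if there are at least $\beta n^{tk-1}$ sets $S$ of $tk-1$ vertices such that both $H[S\cup\{u\}]$ and $H[S\cup\{v\}]$ have perfect matchings; $U\subseteq V$ is *$(\beta,t)$-closed* in $H$ if any two distinct vertices of $U$ are $(\beta,t)$-reachable in $H$. For a partition $\mathcal P=\{V_1,\dots,V_d\}$ of $V$ the index vector of $S\subseteq V$ is $\mathbf i_{\mathcal P}(S)=(|S\cap V_1|,\dots,|S\cap V_d|)\in\mathbb Z^d$, and $I^\mu_{\mathcal P}(H)$ is the set of all vectors $\mathbf i\in\mathbb Z^d$ with nonnegative coordinates summing to $k$ such that at least $\mu n^k$ edges $e\in H$ have $\mathbf i_{\mathcal P}(e)=\mathbf i$. Let $1/n\ll 1/c'\ll\beta,\mu\ll 1/k,1/t,1/C'$;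 that is, for all integers $k\ge2$, $t\ge1$ and every real $C'>0$ there is $\varepsilon_0>0$ such that for all $\beta,\mu\in(0,\varepsilon_0)$ there is $c_0>0$ such that for every $c'>c_0$ there is $n_0$ such that the following holds for all $n\ge n_0$. Suppose that $H$ is a $k$-graph on $n$ vertices and that $\mathcal P=\{V_1,\dots,V_d\}$ is a partition of $V(H)$ into nonempty parts such that each $V_i$ is $(\beta,t)$-closed in $H$. Then in time $O(n^{4tk^2})$ we can find a family $\mathcal F_{abs}$ of at most $c'\log n$ pairwise disjoint sets of $tk^2$ vertices such that $H[F]$ has a perfect matching for every $F\in\mathcal F_{abs}$, and every $k$-vertex set $S$ with $\mathbf i_{\mathcal P}(S)\in I^\mu_{\mathcal P}(H)$ is absorbed by at least $C'$ members of $\mathcal F_{abs}$. Here "in time $O(n^{4tk^2})$ we can find" means: there is a single program (which may depend on the constants $k,t,C',\beta,\mu,c'$ but not on $n$, $H$, $\mathcal P$) for a word RAM with unit-cost instructions and words of $O(\log n)$ bits that, given $\mathcal P$ and the $k$-dimensional adjacency table of $H$, outputs such a family within $K n^{4tk^2}$ steps, where $K$ depends only on $k$ and $t$. -/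

import Mathlib

open Finset

/-! ### Uniform hypergraphs -/

/-- A `k`-uniform hypergraph on the vertex set `V`. -/
structure KGraph (k : ℕ) (V : Type*) where
  edges : Finset (Finset V)
  uniform : ∀ e ∈ edges, e.card = k

namespace KGraph

variable {k : ℕ} {V : Type*} [DecidableEq V]

/-- The edges of the induced subgraph `H[W]`. -/
def inducedEdges (H : KGraph k V) (W : Finset V) : Finset (Finset V) :=
  {e ∈ H.edges | e ⊆ W}

/-- `H[W]` has a perfect matching: a set of pairwise disjoint edges of `H[W]` covering `W`. -/
def HasPerfectMatchingOn (H : KGraph k V) (W : Finset V) : Prop :=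
  ∃ M : Finset (Finset V), M ⊆ H.inducedEdges W ∧
    (M : Set (Finset V)).PairwiseDisjoint id ∧ M.biUnion id = W

/-- `T` absorbs `S`. -/
def Absorbs (H : KGraph k V) (T S : Finset V) : Prop :=
  H.HasPerfectMatchingOn T ∧ H.HasPerfectMatchingOn (T ∪ S)

open Classical in
/-- `u` and `v` are `(β, i)`-reachable: at least `β n ^ (i k - 1)` sets `S` of size `i k - 1` are
such that both `H[S ∪ {u}]` and `H[S ∪ {v}]` have perfect matchings (used only with `1 ≤ i k`). -/
def Reachable [Fintype V] (H : KGraph k V) (β : ℝ) (i : ℕ) (u v : V) : Prop :=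
  β * (Fintype.card V : ℝ) ^ (i * k - 1) ≤
    (#{S ∈ (univ : Finset V).powersetCard (i * k - 1) |
      H.HasPerfectMatchingOn (insert u S) ∧ H.HasPerfectMatchingOn (insert v S)} : ℝ)

/-- `U` is `(β, i)`-closed: any two distinct vertices of `U` are `(β, i)`-reachable. -/
def ClosedIn [Fintype V] (H : KGraph k V) (β : ℝ) (i : ℕ) (U : Finset V) : Prop :=
  ∀ u ∈ U, ∀ v ∈ U, u ≠ v → H.Reachable β i u v

/-- A partition `V_1, …, V_d` of `V` is given by its (surjective) labelling `p : V → Fin d`; this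
is the part with label `j`. -/
def part [Fintype V] {d : ℕ} (p : V → Fin d) (j : Fin d) : Finset V :=
  {v | p v = j}

/-- The index vector of a set `S` with respect to the partition given by `p`. -/
def indexVector [Fintype V] {d : ℕ} (p : V → Fin d) (S : Finset V) : Fin d → ℤ :=
  fun j => (#(S ∩ part p j) : ℤ)

/-- The `k`-vectors (nonnegative, with coordinate sum `k`) that are the index vector of at least
`μ |V| ^ k` edges of `H`. -/
def robustVectors [Fintype V] (H : KGraph k V) {d : ℕ} (p : V → Fin d) (μ : ℝ) :
    Set (Fin d → ℤ) :=
  {i | (∀ j, 0 ≤ i j) ∧ ∑ j, i j = (k : ℤ) ∧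
    μ * (Fintype.card V : ℝ) ^ k ≤ (#{e ∈ H.edges | indexVector p e = i} : ℝ)}

end KGraph

/-! ### A word RAM with a step count

Registers and memory cells hold words of `w` bits; arithmetic is performed modulo `2 ^ w`, and each
elementary instruction, including each test of a branch or of a loop, costs one step. -/

namespace WordRAM

/-- The binary operations on words. Subtraction is truncated, and comparisons give `1` or `0`. -/
inductive BinOp where
  | add | sub | mul | div | mod | lt | eq

/-- The value of a binary operation, before reduction to a word. -/
def BinOp.eval : BinOp → ℕ → ℕ → ℕ
  | .add, a, b => a + b
  | .sub, a, b => a - b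
  | .mul, a, b => a * b
  | .div, a, b => a / b
  | .mod, a, b => a % b
  | .lt, a, b => if a < b then 1 else 0
  | .eq, a, b => if a = b then 1 else 0

/-- Programs. Registers are named by natural numbers. -/
inductive Cmd where
  /-- do nothing -/
  | skip
  /-- `R[r] := c` -/
  | const (r c : ℕ)
  /-- `R[r] := R[a] ∘ R[b]` -/
  | op (f : BinOp) (r a b : ℕ)
  /-- `R[r] := M[R[a]]` -/
  | load (r a : ℕ)
  /-- `M[R[a]] := R[b]` -/
  | store (a b : ℕ)
  /-- sequential composition -/
  | seq (c₁ c₂ : Cmd)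
  /-- if `R[r] ≠ 0` then `c₁` else `c₂` -/
  | cond (r : ℕ) (c₁ c₂ : Cmd)
  /-- while `R[r] ≠ 0` do `c` -/
  | loop (r : ℕ) (c : Cmd)

/-- The contents of the registers and of the memory. -/
structure State where
  reg : ℕ → ℕ
  mem : ℕ → ℕ

/-- Write the number `x`, reduced to a word of `w` bits, to the register `r`. -/
def State.setReg (w : ℕ) (s : State) (r x : ℕ) : State :=
  { s with reg := Function.update s.reg r (x % 2 ^ w) }

/-- Write the word `x` to the memory cell with address `a`. -/
def State.setMem (s : State) (a x : ℕ) : State :=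
  { s with mem := Function.update s.mem a x }

/-- `Exec w c s s' T`: with words of `w` bits, the program `c` started in the state `s` halts in the
state `s'` after exactly `T` steps. -/
inductive Exec (w : ℕ) : Cmd → State → State → ℕ → Prop where
  | skip (s : State) : Exec w .skip s s 1
  | const (s : State) (r c : ℕ) : Exec w (.const r c) s (s.setReg w r c) 1
  | op (s : State) (f : BinOp) (r a b : ℕ) :
      Exec w (.op f r a b) s (s.setReg w r (f.eval (s.reg a) (s.reg b))) 1
  | load (s : State) (r a : ℕ) : Exec w (.load r a) s (s.setReg w r (s.mem (s.reg a))) 1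
  | store (s : State) (a b : ℕ) : Exec w (.store a b) s (s.setMem (s.reg a) (s.reg b)) 1
  | seq {c₁ c₂ : Cmd} {s₀ s₁ s₂ : State} {T₁ T₂ : ℕ} :
      Exec w c₁ s₀ s₁ T₁ → Exec w c₂ s₁ s₂ T₂ → Exec w (.seq c₁ c₂) s₀ s₂ (T₁ + T₂)
  | cond_true {r : ℕ} {c₁ c₂ : Cmd} {s s' : State} {T : ℕ} :
      s.reg r ≠ 0 → Exec w c₁ s s' T → Exec w (.cond r c₁ c₂) s s' (T + 1)
  | cond_false {r : ℕ} {c₁ c₂ : Cmd} {s s' : State} {T : ℕ} :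
      s.reg r = 0 → Exec w c₂ s s' T → Exec w (.cond r c₁ c₂) s s' (T + 1)
  | loop_done {r : ℕ} {c : Cmd} {s : State} : s.reg r = 0 → Exec w (.loop r c) s s 1
  | loop_step {r : ℕ} {c : Cmd} {s₀ s₁ s₂ : State} {T₁ T₂ : ℕ} :
      s₀.reg r ≠ 0 → Exec w c s₀ s₁ T₁ → Exec w (.loop r c) s₁ s₂ T₂ →
      Exec w (.loop r c) s₀ s₂ (T₁ + T₂ + 1)

/-- The initial state on an input: the input is written to the memory from address `0` on, and all
other cells and all registers are `0`. -/
def initState (input : List ℕ) : State where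
  reg := fun _ => 0
  mem := fun a => input.getD a 0

/-- The encoding of a `k`-graph with a partition: the numbers `n` and `d`, the labels of the
vertices `0, …, n - 1`, and the `k`-dimensional adjacency table, in which the entry at position
`v₀ + v₁ n + ⋯ + v_{k-1} n ^ (k-1)` is `1` if `{v₀, …, v_{k-1}}` is an edge and `0` otherwise. -/
def encode {k n d : ℕ} (H : KGraph k (Fin n)) (p : Fin n → Fin d) : List ℕ :=
  [n, d] ++ List.ofFn (fun v : Fin n => (p v : ℕ)) ++
    List.ofFn (fun j : Fin (n ^ k) =>
      if univ.image (finFunctionFinEquiv.symm j) ∈ H.edges then 1 else 0)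

/-- The vertices listed in the `i`-th block of `s` consecutive memory cells after cell `0`. -/
def block (n s : ℕ) (mem : ℕ → ℕ) (i : ℕ) : Finset (Fin n) :=
  {v | ∃ j < s, mem (1 + i * s + j) = (v : ℕ)}

/-- The memory holds the family `F` of `s`-sets as output: cell `0` holds the number of members
of `F`, and the blocks of `s` cells that follow list the members of `F`, each once. -/
def Outputs {n : ℕ} (s : ℕ) (mem : ℕ → ℕ) (F : Finset (Finset (Fin n))) : Prop :=
  mem 0 = #F ∧ (range (mem 0)).image (block n s mem) = F

end WordRAM

/-! Put s = tk². The heart is that every k-set S with a robust index vector is absorbed by a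
proportion at least γ = μβ^k/4 of all s-tuples of vertices. Many edges e share the index vector of
S, so the vertices of e can be paired with those of S inside the parts. Closedness links each pair
by at least βn^(tk-1) connectors, sets that become matchable when either vertex of the pair is
added. An edge with k disjoint connectors has k + k(tk-1) = s vertices. Joining each connector to
its vertex of e matches these s vertices; joining each connector to its vertex of S instead frees e,
which serves as one further matching edge, and S is covered too (`absorbsTuple_of_connectors`,
`card_absorbsTuple`). Configurations with repeated vertices number only O(n^(s-1)).

The family is then chosen greedily, with no randomness. Call a k-tuple rich if at least 1/G of all
s-tuples absorb it, and let the deficit be the total number of hits that rich tuples still lack to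
reach C. The s-tuples meeting one of the O(log n) chosen ones form a vanishing proportion, so
averaging yields a compatible s-tuple that absorbs at least 1/(2G) of the rich k-tuples still short
of hits (`Greedy.exists_eligible`). The deficit is at most Cn^k at first and shrinks by the factor 1
- 1/(2GC) with each choice (`Greedy.inv_run`). Being a natural number, it vanishes after O(log n)
choices (`rounds_le`). Richness is tested by counting, so the algorithm never consults the
partition.

The algorithm is written in a small language of arithmetic with sums of n^j terms. One compilation
theorem (`exec_compile`) gives both the value and the time bound cost * n^deg, so the exponent of
the running time is read off from the nesting of the sums. Finding the next choice has exponent 3s +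
k, and n repetitions stay within 4s because k + 1 ≤ s. A constant costs one step whatever its size,
so the factor depends on k and t only. -/

namespace WordRAM

/-! ### Expressions with bounded sums and their compilation. -/

/-- Arithmetic expressions over the input size `n`, bound variables (de Bruijn indices) and the
memory, with bounded summation `sum j e`, in which the new variable runs over `0, …, n ^ j - 1`. -/
inductive Expr where
  | num (c : ℕ)
  | size
  | var (v : ℕ)
  | op (f : BinOp) (a b : Expr)
  | load (a : Expr)
  | sum (j : ℕ) (e : Expr)

/-- Extend an environment by a value for the variable `0`. -/
def push (i : ℕ) (env : ℕ → ℕ) : ℕ → ℕ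
  | 0 => i
  | v + 1 => env v

@[simp] theorem push_zero (i : ℕ) (env : ℕ → ℕ) : push i env 0 = i := rfl

@[simp] theorem push_succ (i : ℕ) (env : ℕ → ℕ) (v : ℕ) : push i env (v + 1) = env v := rfl

namespace Expr

/-- The value of an expression in words of `w` bits. -/
def eval (w n : ℕ) (mem : ℕ → ℕ) : Expr → (ℕ → ℕ) → ℕ
  | .num c, _ => c % 2 ^ w
  | .size, _ => n % 2 ^ w
  | .var v, env => env v % 2 ^ w
  | .op f a b, env => f.eval (a.eval w n mem env) (b.eval w n mem env) % 2 ^ w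
  | .load a, env => mem (a.eval w n mem env) % 2 ^ w
  | .sum j e, env => (∑ i ∈ range (n ^ j % 2 ^ w), e.eval w n mem (push i env)) % 2 ^ w

/-- The coefficient in the bound `cost * n ^ deg` for the evaluation time. -/
def cost : Expr → ℕ
  | .num _ => 1
  | .size => 2
  | .var _ => 2
  | .op _ a b => a.cost + b.cost + 1
  | .load a => a.cost + 1
  | .sum j e => e.cost + j + 7

/-- The exponent in the bound `cost * n ^ deg` for the evaluation time. -/
def deg : Expr → ℕ
  | .num _ => 0
  | .size => 0
  | .var _ => 0
  | .op _ a b => max a.deg b.deg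
  | .load a => a.deg
  | .sum j e => j + e.deg

end Expr

/-- `R[b] := R[r]` for `r ≠ b`. -/
def copyCmd (b r : ℕ) : Cmd := .seq (.const b 0) (.op .add b b r)

/-- `R[b] := R[0] ^ j`. -/
def powCmd (b : ℕ) : ℕ → Cmd
  | 0 => .const b 1
  | j + 1 => .seq (powCmd b j) (.op .mul b b 0)

/-- Evaluate an expression into the register `b`, with the variable `v` in the register `ρ v`, the
size in register `0`, and the registers from `b` on as scratch space. -/
def Expr.compile : Expr → (ℕ → ℕ) → ℕ → Cmd
  | .num c, _, b => .const b c
  | .size, _, b => copyCmd b 0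
  | .var v, ρ, b => copyCmd b (ρ v)
  | .op f x y, ρ, b => .seq (x.compile ρ b) (.seq (y.compile ρ (b + 1)) (.op f b b (b + 1)))
  | .load a, ρ, b => .seq (a.compile ρ b) (.load b b)
  | .sum j e, ρ, b =>
    .seq (.const b 0) (.seq (powCmd (b + 1) j) (.loop (b + 1)
      (.seq (.const (b + 2) 1) (.seq (.op .sub (b + 1) (b + 1) (b + 2))
        (.seq (e.compile (push (b + 1) ρ) (b + 2)) (.op .add b b (b + 2)))))))

@[simp] theorem State.setReg_mem (w : ℕ) (s : State) (r x : ℕ) : (s.setReg w r x).mem = s.mem := rfl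

@[simp] theorem State.setReg_self (w : ℕ) (s : State) (r x : ℕ) :
    (s.setReg w r x).reg r = x % 2 ^ w := by simp [State.setReg]

theorem State.setReg_of_ne (w : ℕ) (s : State) {r r' : ℕ} (x : ℕ) (h : r' ≠ r) :
    (s.setReg w r x).reg r' = s.reg r' := by simp [State.setReg, h]

theorem exec_copyCmd (w : ℕ) (s : State) {b r : ℕ} (h : r < b) :
    ∃ s', Exec w (copyCmd b r) s s' 2 ∧ s'.mem = s.mem ∧ (∀ r' < b, s'.reg r' = s.reg r') ∧
      s'.reg b = s.reg r % 2 ^ w := by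
  refine ⟨_, .seq (.const s b 0) (.op _ .add b b r), rfl, fun r' hr' => ?_, ?_⟩
  · rw [State.setReg_of_ne _ _ _ hr'.ne, State.setReg_of_ne _ _ _ hr'.ne]
  · rw [State.setReg_self, State.setReg_of_ne _ _ _ h.ne]
    simp [BinOp.eval]

theorem exec_powCmd (w : ℕ) (s : State) {b : ℕ} (hb : 0 < b) (j : ℕ) :
    ∃ s', Exec w (powCmd b j) s s' (j + 1) ∧ s'.mem = s.mem ∧
      (∀ r' < b, s'.reg r' = s.reg r') ∧ s'.reg b = s.reg 0 ^ j % 2 ^ w := by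
  induction j with
  | zero =>
    exact ⟨_, .const s b 1, rfl, fun r' hr' => State.setReg_of_ne _ _ _ hr'.ne, by simp⟩
  | succ j ih =>
    obtain ⟨s', h, hm, hr, hv⟩ := ih
    refine ⟨_, .seq h (.op _ .mul b b 0), hm, fun r' hr' => ?_, ?_⟩
    · rw [State.setReg_of_ne _ _ _ hr'.ne, hr _ hr']
    · rw [State.setReg_self, hv, hr 0 hb]
      simp [BinOp.eval, pow_succ, Nat.mul_mod]

/-- Structural induction with a stack discipline: code with target `b` writes only to registers from
`b` on, so the size and all live loop counters, kept below `b`, survive. In a sum the loop counter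
itself serves as the new variable. Since `1 ≤ n`, every overhead is absorbed into the leading power
of `n`. -/
theorem exec_compile (w n : ℕ) (hn : 1 ≤ n) (e : Expr) : ∀ (ρ : ℕ → ℕ) (b : ℕ) (s : State)
    (env : ℕ → ℕ), 0 < b → s.reg 0 = n → (∀ v, ρ v < b) → (∀ v, s.reg (ρ v) = env v) →
    ∃ s' T, Exec w (e.compile ρ b) s s' T ∧ T ≤ e.cost * n ^ e.deg ∧ s'.mem = s.mem ∧
      (∀ r < b, s'.reg r = s.reg r) ∧ s'.reg b = e.eval w n s.mem env := by
  induction e with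
  | num c =>
    intro ρ b s env hb h0 hρ henv
    exact ⟨_, _, .const s b c, by simp [Expr.cost, Expr.deg], rfl,
      fun r hr => State.setReg_of_ne _ _ _ hr.ne, by simp [Expr.eval]⟩
  | size =>
    intro ρ b s env hb h0 hρ henv
    obtain ⟨s', h, hm, hr, hv⟩ := exec_copyCmd w s hb
    exact ⟨s', _, h, by simp [Expr.cost, Expr.deg], hm, hr, by simp [Expr.eval, hv, h0]⟩
  | var v =>
    intro ρ b s env hb h0 hρ henv
    obtain ⟨s', h, hm, hr, hv⟩ := exec_copyCmd w s (hρ v)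
    exact ⟨s', _, h, by simp [Expr.cost, Expr.deg], hm, hr, by simp [Expr.eval, hv, henv]⟩
  | op f x y ihx ihy =>
    intro ρ b s env hb h0 hρ henv
    obtain ⟨s₁, T₁, h₁, hT₁, hm₁, hr₁, hv₁⟩ := ihx ρ b s env hb h0 hρ henv
    obtain ⟨s₂, T₂, h₂, hT₂, hm₂, hr₂, hv₂⟩ := ihy ρ (b + 1) s₁ env (by omega)
      (by rw [hr₁ 0 hb, h0]) (fun v => (hρ v).trans (by omega))
      (fun v => by rw [hr₁ _ (hρ v), henv])
    refine ⟨_, _, .seq h₁ (.seq h₂ (.op _ f b b (b + 1))), ?_, by simp [hm₁, hm₂], fun r hr => ?_, ?_⟩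
    · have e1 : n ^ x.deg ≤ n ^ (max x.deg y.deg) := Nat.pow_le_pow_right hn (le_max_left _ _)
      have e2 : n ^ y.deg ≤ n ^ (max x.deg y.deg) := Nat.pow_le_pow_right hn (le_max_right _ _)
      have e3 : 1 ≤ n ^ (max x.deg y.deg) := Nat.one_le_pow _ _ hn
      have e4 := Nat.mul_le_mul_left x.cost e1
      have e5 := Nat.mul_le_mul_left y.cost e2
      simp only [Expr.cost, Expr.deg, add_mul, one_mul]
      omega
    · rw [State.setReg_of_ne _ _ _ hr.ne, hr₂ _ (by omega), hr₁ _ hr]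
    · rw [State.setReg_self, hv₂, hr₂ b (by omega), hv₁, hm₁]
      rfl
  | load a iha =>
    intro ρ b s env hb h0 hρ henv
    obtain ⟨s₁, T₁, h₁, hT₁, hm₁, hr₁, hv₁⟩ := iha ρ b s env hb h0 hρ henv
    refine ⟨_, _, .seq h₁ (.load _ b b), ?_, by simp [hm₁], fun r hr => ?_, ?_⟩
    · have e3 : 1 ≤ n ^ a.deg := Nat.one_le_pow _ _ hn
      simp only [Expr.cost, Expr.deg, add_mul, one_mul]
      omega
    · rw [State.setReg_of_ne _ _ _ hr.ne, hr₁ _ hr]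
    · rw [State.setReg_self, hv₁, hm₁]
      rfl
  | sum j e ih =>
    intro ρ b s env hb h0 hρ henv
    have loop : ∀ (L : ℕ) (s : State), L < 2 ^ w → s.reg 0 = n → (∀ v, s.reg (ρ v) = env v) →
        s.reg (b + 1) = L → s.reg b < 2 ^ w →
        ∃ s' T, Exec w (.loop (b + 1)
          (.seq (.const (b + 2) 1) (.seq (.op .sub (b + 1) (b + 1) (b + 2))
            (.seq (e.compile (push (b + 1) ρ) (b + 2)) (.op .add b b (b + 2)))))) s s' T ∧
          T ≤ L * (e.cost * n ^ e.deg + 4) + 1 ∧ s'.mem = s.mem ∧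
          (∀ r < b, s'.reg r = s.reg r) ∧
          s'.reg b = (s.reg b + ∑ i ∈ range L, e.eval w n s.mem (push i env)) % 2 ^ w := by
      intro L
      induction L with
      | zero =>
        intro s _ _ _ hL hlt
        exact ⟨s, 1, .loop_done hL, by simp, rfl, fun _ _ => rfl, by
          simp [Nat.mod_eq_of_lt hlt]⟩
      | succ L ihL =>
        intro s hLw h0 henv hL hlt
        -- A nonzero counter fits in a word, so `w ≠ 0` and the constant `1` used for the decrement
        -- is not reduced to `0`.
        have hw1 : 1 % 2 ^ w = 1 := Nat.mod_eq_of_lt (by omega)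
        set s₁ := (s.setReg w (b + 2) 1).setReg w (b + 1)
          (BinOp.sub.eval ((s.setReg w (b + 2) 1).reg (b + 1)) ((s.setReg w (b + 2) 1).reg (b + 2)))
          with hs₁
        have r1 : ∀ r < b + 1, s₁.reg r = s.reg r := fun r hr => by
          rw [hs₁, State.setReg_of_ne _ _ _ (by omega), State.setReg_of_ne _ _ _ (by omega)]
        have c1 : s₁.reg (b + 1) = L := by
          rw [hs₁, State.setReg_self, State.setReg_self, State.setReg_of_ne _ _ _ (by omega), hL,
            hw1]
          simp only [BinOp.eval, Nat.add_sub_cancel]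
          exact Nat.mod_eq_of_lt (by omega)
        obtain ⟨s₂, T₂, h₂, hT₂, hm₂, hr₂, hv₂⟩ := ih (push (b + 1) ρ) (b + 2) s₁ (push L env)
          (by omega) (by rw [r1 0 (by omega), h0])
          (fun v => by
            cases v with
            | zero => simp
            | succ v => simpa using (hρ v).trans (by omega))
          (fun v => by
            cases v with
            | zero => simpa using c1
            | succ v => simpa using (r1 _ ((hρ v).trans (by omega))).trans (henv v))
        set s₃ := s₂.setReg w b (BinOp.add.eval (s₂.reg b) (s₂.reg (b + 2))) with hs₃
        have m3 : s₃.mem = s.mem := by rw [hs₃, State.setReg_mem, hm₂, hs₁]; rfl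
        have r3 : ∀ r < b, s₃.reg r = s.reg r := fun r hr => by
          rw [hs₃, State.setReg_of_ne _ _ _ (by omega), hr₂ _ (by omega), r1 _ (by omega)]
        have v3 : s₃.reg b = (s.reg b + e.eval w n s.mem (push L env)) % 2 ^ w := by
          rw [hs₃, State.setReg_self, hv₂, hr₂ _ (by omega), r1 _ (by omega)]
          rfl
        obtain ⟨s₄, T₄, h₄, hT₄, hm₄, hr₄, hv₄⟩ := ihL s₃ (by omega)
          (by rw [r3 0 hb, h0]) (fun v => by rw [r3 _ (hρ v), henv])
          (by rw [hs₃, State.setReg_of_ne _ _ _ (by omega), hr₂ _ (by omega), c1])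
          (by rw [v3]; exact Nat.mod_lt _ (by positivity))
        refine ⟨s₄, _, .loop_step (by omega)
          (.seq (.const s (b + 2) 1) (.seq (.op _ .sub (b + 1) (b + 1) (b + 2))
            (.seq h₂ (.op _ .add b b (b + 2))))) h₄, ?_, by rw [hm₄, m3],
            fun r hr => by rw [hr₄ _ hr, r3 _ hr], ?_⟩
        · rw [Nat.succ_mul]; omega
        -- The counter is decremented before the body runs, so the terms are added in the order `L,
        -- …, 0`; the last term of the range comes first.
        · rw [hv₄, v3, m3, sum_range_succ, Nat.mod_add_mod]
          congr 1
          omega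
    obtain ⟨s₁, h₁, hm₁, hr₁, hv₁⟩ := exec_powCmd w (s.setReg w b 0) (b := b + 1) (by omega) j
    have r1 : ∀ r < b, s₁.reg r = s.reg r := fun r hr => by
      rw [hr₁ _ (by omega), State.setReg_of_ne _ _ _ hr.ne]
    have hb0 : s₁.reg b = 0 := by rw [hr₁ _ (by omega), State.setReg_self, Nat.zero_mod]
    have hpos : 0 < 2 ^ w := by positivity
    obtain ⟨s₂, T₂, h₂, hT₂, hm₂, hr₂, hv₂⟩ := loop (n ^ j % 2 ^ w) s₁ (Nat.mod_lt _ hpos)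
      (by rw [r1 0 hb, h0]) (fun v => by rw [r1 _ (hρ v), henv])
      (by rw [hv₁, State.setReg_of_ne _ _ _ hb.ne, h0]) (by rw [hb0]; exact hpos)
    refine ⟨s₂, _, .seq (.const s b 0) (.seq h₁ h₂), ?_, by rw [hm₂, hm₁]; rfl,
      fun r hr => by rw [hr₂ _ hr, r1 _ hr], ?_⟩
    · have e1 := Nat.mul_le_mul_right (e.cost * n ^ e.deg + 4) (Nat.mod_le (n ^ j) (2 ^ w))
      have e2 : 1 ≤ n ^ e.deg := Nat.one_le_pow _ _ hn
      have e3 : 1 ≤ n ^ j := Nat.one_le_pow _ _ hn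
      have e4 : n ^ j ≤ n ^ j * n ^ e.deg := Nat.le_mul_of_pos_right _ e2
      have e5 : n ^ j * (e.cost * n ^ e.deg + 4) = e.cost * (n ^ j * n ^ e.deg) + 4 * n ^ j := by
        ring
      have e6 : j + 3 ≤ (j + 3) * (n ^ j * n ^ e.deg) := Nat.le_mul_of_pos_right _ (by omega)
      simp only [Expr.cost, Expr.deg, pow_add]
      calc _ ≤ e.cost * (n ^ j * n ^ e.deg) + 4 * (n ^ j * n ^ e.deg) +
            (j + 3) * (n ^ j * n ^ e.deg) := by omega
        _ = _ := by ring
    · rw [hv₂, hb0, hm₁, zero_add]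
      rfl

/-! ### Sweeps that write to the memory. -/

/-- For `c = n ^ j - 1, …, 0`, with `c` as the variable `0`, write the value of `v` to the
address `a`. -/
def storeLoop (j : ℕ) (a v : Expr) : Cmd :=
  .seq (powCmd 1 j) (.loop 1 (.seq (.const 2 1) (.seq (.op .sub 1 1 2)
    (.seq (a.compile (push 1 fun _ => 0) 2) (.seq (v.compile (push 1 fun _ => 0) 3)
      (.store 2 3))))))

/-- The effect of `storeLoop` on the memory. -/
def sweep (w n : ℕ) (a v : Expr) : ℕ → (ℕ → ℕ) → ℕ → ℕ
  | 0, mem => mem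
  | c + 1, mem => sweep w n a v c (Function.update mem (a.eval w n mem (push c fun _ => n))
      (v.eval w n mem (push c fun _ => n)))

/-- The counter sits in register `1`; all further variables are sent to register `0`, which is why
the environment defaults to `n`. The value is computed from register `3` on, so the address in
register `2` survives, and both see the memory left by the earlier iterations. -/
theorem exec_storeLoop (w n : ℕ) (hn : 1 ≤ n) (j : ℕ) (a v : Expr) (s : State)
    (h0 : s.reg 0 = n) :
    ∃ s' T, Exec w (storeLoop j a v) s s' T ∧
      T ≤ (a.cost + v.cost + j + 6) * n ^ (j + max a.deg v.deg) ∧ s'.reg 0 = n ∧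
      s'.mem = sweep w n a v (n ^ j % 2 ^ w) s.mem := by
  have loop : ∀ (L : ℕ) (s : State), L < 2 ^ w → s.reg 0 = n → s.reg 1 = L →
      ∃ s' T, Exec w (.loop 1 (.seq (.const 2 1) (.seq (.op .sub 1 1 2)
        (.seq (a.compile (push 1 fun _ => 0) 2) (.seq (v.compile (push 1 fun _ => 0) 3)
          (.store 2 3)))))) s s' T ∧
        T ≤ L * (a.cost * n ^ a.deg + v.cost * n ^ v.deg + 4) + 1 ∧ s'.reg 0 = n ∧
        s'.mem = sweep w n a v L s.mem := by
    intro L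
    induction L with
    | zero =>
      intro s _ h0 hL
      exact ⟨s, 1, .loop_done hL, by simp, h0, rfl⟩
    | succ L ih =>
      intro s hLw h0 hL
      have hw1 : 1 % 2 ^ w = 1 := Nat.mod_eq_of_lt (by omega)
      set s₁ := (s.setReg w 2 1).setReg w 1
        (BinOp.sub.eval ((s.setReg w 2 1).reg 1) ((s.setReg w 2 1).reg 2)) with hs₁
      have z1 : s₁.reg 0 = n := by
        rw [hs₁, State.setReg_of_ne _ _ _ (by omega), State.setReg_of_ne _ _ _ (by omega), h0]
      have c1 : s₁.reg 1 = L := by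
        rw [hs₁, State.setReg_self, State.setReg_self, State.setReg_of_ne _ _ _ (by omega), hL, hw1]
        simp only [BinOp.eval, Nat.add_sub_cancel]
        exact Nat.mod_eq_of_lt (by omega)
      have hρ : ∀ v, push 1 (fun _ => 0) v < 2 := fun v => by cases v <;> simp
      obtain ⟨s₂, T₂, h₂, hT₂, hm₂, hr₂, hv₂⟩ := exec_compile w n hn a (push 1 fun _ => 0) 2 s₁
        (push L fun _ => n) (by omega) z1 hρ (fun v => by cases v <;> simp [z1, c1])
      obtain ⟨s₃, T₃, h₃, hT₃, hm₃, hr₃, hv₃⟩ := exec_compile w n hn v (push 1 fun _ => 0) 3 s₂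
        (push L fun _ => n) (by omega) (by rw [hr₂ 0 (by omega), z1])
        (fun v => (hρ v).trans (by omega))
        (fun v => by rw [hr₂ _ (hρ v)]; cases v <;> simp [z1, c1])
      have hm₁ : s₁.mem = s.mem := rfl
      obtain ⟨s₄, T₄, h₄, hT₄, hr₄, hm₄⟩ := ih (s₃.setMem (s₃.reg 2) (s₃.reg 3)) (by omega)
        (by show s₃.reg 0 = n; rw [hr₃ _ (by omega), hr₂ _ (by omega), z1])
        (by show s₃.reg 1 = L; rw [hr₃ _ (by omega), hr₂ _ (by omega), c1])
      refine ⟨s₄, _, .loop_step (by omega) (.seq (.const s 2 1) (.seq (.op _ .sub 1 1 2)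
        (.seq h₂ (.seq h₃ (.store _ 2 3))))) h₄, ?_, hr₄, ?_⟩
      · rw [Nat.succ_mul]; omega
      · rw [hm₄, sweep]
        simp only [State.setMem]
        rw [hv₃, hr₃ 2 (by omega), hv₂, hm₃, hm₂, hm₁]
  obtain ⟨s₁, h₁, hm₁, hr₁, hv₁⟩ := exec_powCmd w s (b := 1) (by omega) j
  obtain ⟨s₂, T₂, h₂, hT₂, hr₂, hm₂⟩ := loop (n ^ j % 2 ^ w) s₁ (Nat.mod_lt _ (by positivity))
    (by rw [hr₁ 0 (by omega), h0]) (by rw [hv₁, h0])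
  refine ⟨s₂, _, .seq h₁ h₂, ?_, hr₂, by rw [hm₂, hm₁]⟩
  have e0 := Nat.mul_le_mul_right (a.cost * n ^ a.deg + v.cost * n ^ v.deg + 4)
    (Nat.mod_le (n ^ j) (2 ^ w))
  set D := max a.deg v.deg
  have e1 : n ^ a.deg ≤ n ^ D := Nat.pow_le_pow_right hn (le_max_left _ _)
  have e2 : n ^ v.deg ≤ n ^ D := Nat.pow_le_pow_right hn (le_max_right _ _)
  have e3 : 1 ≤ n ^ D := Nat.one_le_pow _ _ hn
  have e4 : 1 ≤ n ^ j := Nat.one_le_pow _ _ hn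
  have e5 : n ^ j * (a.cost * n ^ a.deg + v.cost * n ^ v.deg + 4) ≤
      n ^ j * (a.cost * n ^ D + v.cost * n ^ D + 4 * n ^ D) := by gcongr; omega
  have e6 : j + 2 ≤ (j + 2) * (n ^ j * n ^ D) := Nat.le_mul_of_pos_right _ (by positivity)
  rw [pow_add]
  calc _ ≤ n ^ j * (a.cost * n ^ D + v.cost * n ^ D + 4 * n ^ D) + (j + 2) * (n ^ j * n ^ D) := by
        omega
    _ = _ := by ring

end WordRAM

/-! ### The greedy selection -/

namespace Greedy

open Classical in
/-- The number of recorded members `c i - 1` that are related to `Y`. -/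
noncomputable def hits (n : ℕ) (Ab : ℕ → ℕ → Prop) (c : ℕ → ℕ) (Y : ℕ) : ℕ :=
  #{i ∈ range n | 0 < c i ∧ Ab (c i - 1) Y}

open Classical in
/-- At least a `1 / G` fraction of the candidates is related to `Y`. -/
def Rich (NX G : ℕ) (Ab : ℕ → ℕ → Prop) (Y : ℕ) : Prop :=
  NX ≤ G * #{X ∈ range NX | Ab X Y}

/-- `Y` still has to be hit. -/
def Wanting (n NX G C : ℕ) (Ab : ℕ → ℕ → Prop) (c : ℕ → ℕ) (Y : ℕ) : Prop :=
  hits n Ab c Y < C ∧ Rich NX G Ab Y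

open Classical in
/-- The number of those `Y` that still have to be hit. -/
noncomputable def wanting (n NX NY G C : ℕ) (Ab : ℕ → ℕ → Prop) (c : ℕ → ℕ) : ℕ :=
  #{Y ∈ range NY | Wanting n NX G C Ab c Y}

open Classical in
/-- The number of those `Y` that still have to be hit and are hit by `X`. -/
noncomputable def gain (n NX NY G C : ℕ) (Ab : ℕ → ℕ → Prop) (c : ℕ → ℕ) (X : ℕ) : ℕ :=
  #{Y ∈ range NY | Wanting n NX G C Ab c Y ∧ Ab X Y}

open Classical in
/-- `X` may be chosen: it is compatible with the recorded members, and its gain is large. -/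
def Eligible (n NX NY G C : ℕ) (Ab Dj : ℕ → ℕ → Prop) (c : ℕ → ℕ) (X : ℕ) : Prop :=
  #{i ∈ range n | 0 < c i ∧ ¬ Dj (c i - 1) X} = 0 ∧
    (0 < gain n NX NY G C Ab c X ∧
      ¬ 2 * G * gain n NX NY G C Ab c X < wanting n NX NY G C Ab c)

open Classical in
/-- The successor of the first eligible candidate, or `0` if there is none. -/
noncomputable def select (n NX NY G C : ℕ) (Ab Dj : ℕ → ℕ → Prop) (c : ℕ → ℕ) : ℕ :=
  (#{X ∈ range NX | #{X' ∈ range NX | ¬ X < X' ∧ Eligible n NX NY G C Ab Dj c X'} = 0} + 1) %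
    (NX + 1)

/-- The record after `r` rounds. -/
noncomputable def run (n NX NY G C : ℕ) (Ab Dj : ℕ → ℕ → Prop) : ℕ → ℕ → ℕ
  | 0 => fun _ => 0
  | r + 1 => Function.update (run n NX NY G C Ab Dj r) r
      (select n NX NY G C Ab Dj (run n NX NY G C Ab Dj r))

variable {n NX NY G C : ℕ} {Ab Dj : ℕ → ℕ → Prop} {c : ℕ → ℕ}

/-- The positions `X` with no eligible candidate up to and including `X` are exactly those before
the first eligible one, so their number is its index. If none is eligible the count is `NX`, and
reduction modulo `NX + 1` turns `NX + 1` into `0`. -/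
theorem select_spec :
    (select n NX NY G C Ab Dj c = 0 ∧ ∀ X < NX, ¬ Eligible n NX NY G C Ab Dj c X) ∨
    ∃ X < NX, Eligible n NX NY G C Ab Dj c X ∧ select n NX NY G C Ab Dj c = X + 1 := by
  classical
  by_cases h : ∃ X, X < NX ∧ Eligible n NX NY G C Ab Dj c X
  · right
    refine ⟨Nat.find h, (Nat.find_spec h).1, (Nat.find_spec h).2, ?_⟩
    have : {X ∈ range NX | #{X' ∈ range NX | ¬ X < X' ∧ Eligible n NX NY G C Ab Dj c X'} = 0} =
        range (Nat.find h) := by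
      ext X
      simp only [mem_filter, mem_range, card_eq_zero, filter_eq_empty_iff, not_and, not_lt,
        Nat.lt_find_iff]
      constructor
      · rintro ⟨_, h2⟩ m hm hmX hE
        exact h2 hmX hm hE
      · intro h2
        refine ⟨?_, fun X' hX' hle hE => h2 X' hle hX' hE⟩
        by_contra hX
        exact h2 (Nat.find h) (by have := (Nat.find_spec h).1; omega) (Nat.find_spec h).1
          (Nat.find_spec h).2
    unfold select
    rw [this, card_range, Nat.mod_eq_of_lt]
    have := (Nat.find_spec h).1
    omega
  · left
    push Not at h
    refine ⟨?_, h⟩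
    have : {X ∈ range NX | #{X' ∈ range NX | ¬ X < X' ∧ Eligible n NX NY G C Ab Dj c X'} = 0} =
        range NX := by
      refine filter_true_of_mem fun X _ => ?_
      rw [card_eq_zero, filter_eq_empty_iff]
      exact fun X' hX' hE => h X' (mem_range.1 hX') hE.2
    unfold select
    rw [this, card_range, Nat.mod_self]

open Classical in
-- Averaging. The recorded members block at most a `1 / (2 G)` proportion of the candidates, so a
-- rich `Y` keeps at least that proportion among the free ones. Counting pairs of a free candidate
-- and a wanting `Y` that it hits, some free candidate reaches the average.
theorem exists_eligible {D m : ℕ} (hNX : 0 < NX) (hn : 0 < n)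
    (hD : ∀ X < NX, #{X' ∈ range NX | ¬ Dj X X'} * n ≤ D * NX)
    (hc : ∀ i < n, 0 < c i → c i - 1 < NX) (hm : #{i ∈ range n | 0 < c i} ≤ m)
    (hmn : 2 * G * D * m ≤ n) (hW : 0 < wanting n NX NY G C Ab c) :
    ∃ X < NX, Eligible n NX NY G C Ab Dj c X := by
  by_contra hcon
  push Not at hcon
  set free : Finset ℕ := {X ∈ range NX | #{i ∈ range n | 0 < c i ∧ ¬ Dj (c i - 1) X} = 0} with hfree
  -- few candidates are incompatible
  have hblocked : #(range NX \ free) * n ≤ m * (D * NX) := by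
    have hsub : range NX \ free ⊆
        {i ∈ range n | 0 < c i}.biUnion fun i => {X ∈ range NX | ¬ Dj (c i - 1) X} := by
      intro X hX
      simp only [hfree, mem_sdiff, mem_filter, not_and] at hX
      obtain ⟨i, hi⟩ := card_ne_zero.1 (hX.2 hX.1)
      simp only [mem_filter] at hi
      simp only [mem_biUnion, mem_filter]
      exact ⟨i, ⟨hi.1, hi.2.1⟩, hX.1, hi.2.2⟩
    calc #(range NX \ free) * n
        ≤ (∑ i ∈ range n with 0 < c i, #{X ∈ range NX | ¬ Dj (c i - 1) X}) * n :=
          Nat.mul_le_mul_right _ ((card_le_card hsub).trans card_biUnion_le)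
      _ = ∑ i ∈ range n with 0 < c i, #{X ∈ range NX | ¬ Dj (c i - 1) X} * n := by rw [sum_mul]
      _ ≤ ∑ i ∈ range n with 0 < c i, D * NX := by
          refine sum_le_sum fun i hi => hD _ ?_
          simp only [mem_filter, mem_range] at hi
          exact hc i hi.1 hi.2
      _ = #{i ∈ range n | 0 < c i} * (D * NX) := by rw [sum_const, smul_eq_mul]
      _ ≤ _ := Nat.mul_le_mul_right _ hm
  have hblocked' : 2 * G * #(range NX \ free) ≤ NX := by
    refine Nat.le_of_mul_le_mul_right ?_ hn
    calc 2 * G * #(range NX \ free) * n = 2 * G * (#(range NX \ free) * n) := by ring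
      _ ≤ 2 * G * (m * (D * NX)) := Nat.mul_le_mul_left _ hblocked
      _ = (2 * G * D * m) * NX := by ring
      _ ≤ n * NX := Nat.mul_le_mul_right _ hmn
      _ = NX * n := mul_comm _ _
  have hmany : ∀ Y, Rich NX G Ab Y → NX ≤ 2 * G * #{X ∈ free | Ab X Y} := by
    intro Y hY
    have h1 : #{X ∈ range NX | Ab X Y} ≤ #{X ∈ free | Ab X Y} + #(range NX \ free) := by
      refine (card_le_card fun X hX => ?_).trans (card_union_le _ _)
      simp only [mem_filter, mem_union, mem_sdiff] at hX ⊢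
      by_cases hXf : X ∈ free
      · exact Or.inl ⟨hXf, hX.2⟩
      · exact Or.inr ⟨hX.1, hXf⟩
    have h2 := Nat.mul_le_mul_left (2 * G) h1
    have h3 : NX ≤ G * #{X ∈ range NX | Ab X Y} := hY
    rw [mul_add] at h2
    have h4 : 2 * G * #{X ∈ range NX | Ab X Y} = 2 * (G * #{X ∈ range NX | Ab X Y}) := by ring
    omega
  set W : Finset ℕ := {Y ∈ range NY | Wanting n NX G C Ab c Y} with hWdef
  have hWcard : wanting n NX NY G C Ab c = #W := rfl
  have hlow : #W * NX ≤ 2 * G * ∑ X ∈ free, gain n NX NY G C Ab c X := by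
    have hswap : ∑ X ∈ free, gain n NX NY G C Ab c X = ∑ Y ∈ W, #{X ∈ free | Ab X Y} := by
      have : ∀ X, gain n NX NY G C Ab c X = #{Y ∈ W | Ab X Y} := fun X => by
        rw [hWdef, filter_filter]; rfl
      simp only [this, card_filter]
      exact sum_comm
    rw [hswap, mul_sum, ← smul_eq_mul, ← sum_const]
    refine sum_le_sum fun Y hY => hmany Y ?_
    exact (mem_filter.1 hY).2.2
  -- If no candidate is eligible, the gain is either zero or strictly too small; the positivity of
  -- `wanting` gives the `+ 1` in the first case too.
  have hup : ∀ X ∈ free, 2 * G * gain n NX NY G C Ab c X + 1 ≤ #W := by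
    intro X hX
    have hX' := mem_filter.1 hX
    have := hcon X (mem_range.1 hX'.1)
    simp only [Eligible, not_and, not_not] at this
    rcases Nat.eq_zero_or_pos (gain n NX NY G C Ab c X) with h | h
    · rw [h, ← hWcard]; omega
    · have := this hX'.2 h
      rw [← hWcard]; omega
  have hfr : #free ≤ NX := (card_le_card (filter_subset _ _)).trans (card_range _).le
  have hsum : 2 * G * ∑ X ∈ free, gain n NX NY G C Ab c X + #free ≤ #free * #W := by
    rw [mul_sum, card_eq_sum_ones free, ← sum_add_distrib, sum_mul]
    exact sum_le_sum fun X hX => by rw [one_mul]; exact hup X hX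
  -- Strictness of the comparison comes from the summand `#free`, so an empty `free` is refuted
  -- separately, by the lower bound `hlow`.
  rcases Nat.eq_zero_or_pos #free with h0 | h0
  · rw [hWcard] at hW
    have : 0 < #W * NX := Nat.mul_pos hW hNX
    rw [h0] at hsum
    omega
  · have := Nat.mul_le_mul_right #W hfr
    have h5 : NX * #W = #W * NX := mul_comm _ _
    omega

/-! ### The deficit as a potential function. -/

open Classical in
/-- The total number of hits that are still missing. -/
noncomputable def deficit (n NX NY G C : ℕ) (Ab : ℕ → ℕ → Prop) (c : ℕ → ℕ) : ℕ :=
  ∑ Y ∈ range NY with Rich NX G Ab Y, (C - hits n Ab c Y)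

open Classical in
theorem hits_update {r X : ℕ} (hr : r < n) (hcr : c r = 0) (Y : ℕ) :
    hits n Ab (Function.update c r (X + 1)) Y = hits n Ab c Y + if Ab X Y then 1 else 0 := by
  have hU : ∀ i ∈ range n, i ≠ r → ((0 < Function.update c r (X + 1) i ∧
      Ab (Function.update c r (X + 1) i - 1) Y) ↔ (0 < c i ∧ Ab (c i - 1) Y)) := by
    intro i _ hi
    rw [Function.update_of_ne hi]
  unfold hits
  split_ifs with h
  · rw [← card_insert_of_notMem (a := r) (by simp [hcr])]
    congr 1
    ext i
    by_cases hi : i = r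
    · subst hi; simp [h, hr]
    · simp [hi]
  · rw [add_zero]
    congr 1
    ext i
    by_cases hi : i = r
    · subst hi; simp [h, hcr]
    · simp [hi]

/-- A rich `Y` lacks one hit fewer exactly when `X` hits it while it is short of `C`, which is when
it counts towards the gain. Truncated subtraction leaves satisfied `Y` at zero. -/
theorem deficit_update {r X : ℕ} (hr : r < n) (hcr : c r = 0) :
    deficit n NX NY G C Ab (Function.update c r (X + 1)) + gain n NX NY G C Ab c X =
      deficit n NX NY G C Ab c := by
  classical
  have hg : gain n NX NY G C Ab c X = ∑ Y ∈ range NY with Rich NX G Ab Y,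
      if hits n Ab c Y < C ∧ Ab X Y then 1 else 0 := by
    unfold gain
    rw [← card_filter, filter_filter]
    congr 1
    ext Y
    simp only [mem_filter]
    unfold Wanting
    tauto
  rw [hg]
  unfold deficit
  rw [← sum_add_distrib]
  refine sum_congr rfl fun Y _ => ?_
  rw [hits_update hr hcr]
  by_cases h1 : Ab X Y <;> by_cases h2 : hits n Ab c Y < C <;> simp only [h1, h2, and_true,
    and_false, if_true, if_false] <;> omega

theorem deficit_le : deficit n NX NY G C Ab c ≤ C * wanting n NX NY G C Ab c := by
  classical
  unfold deficit wanting
  rw [mul_comm, ← smul_eq_mul, ← sum_const]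
  have : {Y ∈ range NY | Wanting n NX G C Ab c Y} =
      {Y ∈ {Y ∈ range NY | Rich NX G Ab Y} | hits n Ab c Y < C} := by
    rw [filter_filter]
    ext Y
    simp only [mem_filter]
    unfold Wanting
    tauto
  rw [this]
  calc ∑ Y ∈ range NY with Rich NX G Ab Y, (C - hits n Ab c Y)
      = ∑ Y ∈ {Y ∈ range NY | Rich NX G Ab Y} with hits n Ab c Y < C, (C - hits n Ab c Y) := by
        refine (sum_filter_of_ne fun Y _ h => ?_).symm
        omega
    _ ≤ _ := sum_le_sum fun Y _ => Nat.sub_le _ _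

/-- The invariant of the rounds: an initial segment, of length `m`, is recorded. -/
structure Inv (n NX NY G C : ℕ) (Ab Dj : ℕ → ℕ → Prop) (M : ℕ) (r m : ℕ) (c : ℕ → ℕ) : Prop where
  zero : ∀ i, m ≤ i → c i = 0
  mem : ∀ i < m, 0 < c i ∧ c i - 1 < NX ∧ ∃ Y < NY, Ab (c i - 1) Y
  disj : ∀ j < m, ∀ i < j, Dj (c i - 1) (c j - 1)
  le_rounds : m ≤ r
  le_bound : m ≤ M
  finished : m = r ∨ wanting n NX NY G C Ab c = 0
  potential : (deficit n NX NY G C Ab c : ℝ) ≤ (1 - 1 / (2 * G * C)) ^ m * (C * NY)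

open Classical in
-- A successful round multiplies the deficit by at most `1 - 1 / (2 G C)`, since the deficit is at
-- most `C * wanting`, hence at most `2 G C` times the gain. Success also needs a positive deficit,
-- so `hlog` keeps the number of members at most `M`; within this bound `exists_eligible` shows that
-- a failed selection means nothing is wanting.
theorem inv_run {D M : ℕ} (hNX : 0 < NX) (hG : 0 < G) (hC : 0 < C)
    (hD : ∀ X < NX, #{X' ∈ range NX | ¬ Dj X X'} * n ≤ D * NX)
    (hM : 2 * G * D * M ≤ n)
    (hlog : ∀ m : ℕ, (1 : ℝ) ≤ (1 - 1 / (2 * G * C)) ^ m * (C * NY) → m + 1 ≤ M) (r : ℕ)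
    (hr : r ≤ n) : ∃ m, Inv n NX NY G C Ab Dj M r m (run n NX NY G C Ab Dj r) := by
  induction r with
  | zero =>
    refine ⟨0, ⟨fun _ _ => rfl, by simp, by simp, le_rfl, Nat.zero_le _, Or.inl rfl, ?_⟩⟩
    have h1 : deficit n NX NY G C Ab (run n NX NY G C Ab Dj 0) ≤ C * NY :=
      deficit_le.trans (Nat.mul_le_mul_left _
        ((card_le_card (filter_subset _ _)).trans (card_range _).le))
    simpa using mod_cast h1
  | succ r ih =>
    obtain ⟨m, hI⟩ := ih (by omega)
    set c := run n NX NY G C Ab Dj r with hc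
    have hrun : run n NX NY G C Ab Dj (r + 1) =
      Function.update c r (select n NX NY G C Ab Dj c) := rfl
    rw [hrun]
    have hcr : c r = 0 := hI.zero r hI.le_rounds
    have hGC : (0 : ℝ) < 2 * G * C := by positivity
    rcases select_spec (n := n) (NX := NX) (NY := NY) (G := G) (C := C) (Ab := Ab) (Dj := Dj)
      (c := c) with ⟨hs, hno⟩ | ⟨X, hX, hE, hs⟩
    -- A failed round writes `0` over the `0` already at position `r`, so the record does not
    -- change.
    · rw [hs, ← hcr, Function.update_eq_self]
      refine ⟨m, hI.zero, hI.mem, hI.disj, hI.le_rounds.trans (Nat.le_succ _), hI.le_bound,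
        Or.inr ?_, hI.potential⟩
      by_contra hW
      obtain ⟨X, hX, hE⟩ := exists_eligible (c := c) (m := M) hNX (by omega) hD
        (fun i _ hi => (hI.mem i (by by_contra h; rw [hI.zero i (by omega)] at hi; omega)).2.1)
        (by
          refine le_trans (card_le_card (t := range m) fun i hi => ?_)
            ((card_range m).le.trans hI.le_bound)
          simp only [mem_filter] at hi
          rw [mem_range]
          by_contra h
          rw [hI.zero i (by omega)] at hi
          omega) hM (Nat.pos_of_ne_zero hW)
      exact hno X hX hE
    · obtain ⟨hE1, hE2, hE3⟩ := hE
      have hW : 0 < wanting n NX NY G C Ab c := by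
        obtain ⟨Y, hY⟩ := card_pos.1 hE2
        exact card_pos.2 ⟨Y, by
          simp only [mem_filter] at hY ⊢
          exact ⟨hY.1, hY.2.1⟩⟩
      have hmr : m = r := hI.finished.resolve_right hW.ne'
      subst hmr
      rw [hs]
      have hdef := deficit_update (NX := NX) (NY := NY) (G := G) (C := C) (Ab := Ab) (X := X)
        (show m < n by omega) hcr
      -- The gain is positive and is subtracted from the deficit, so the deficit before this round
      -- is a positive integer.
      have hpot1 : (1 : ℝ) ≤ deficit n NX NY G C Ab c := by
        exact_mod_cast (by omega : 1 ≤ deficit n NX NY G C Ab c)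
      have hold : ∀ i < m, Function.update c m (X + 1) i = c i := fun i hi =>
        Function.update_of_ne (by omega) _ _
      refine ⟨m + 1, fun i hi => ?_, fun i hi => ?_, fun j hj i hi => ?_, le_rfl, ?_,
        Or.inl rfl, ?_⟩
      · rw [Function.update_of_ne (by omega)]
        exact hI.zero i (by omega)
      · rcases Nat.lt_succ_iff_lt_or_eq.1 hi with h | rfl
        · rw [hold i h]
          exact hI.mem i h
        · rw [Function.update_self]
          obtain ⟨Y, hY⟩ := card_pos.1 hE2
          simp only [mem_filter, mem_range] at hY
          exact ⟨Nat.succ_pos _, hX, Y, hY.1, hY.2.2⟩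
      · rcases Nat.lt_succ_iff_lt_or_eq.1 hj with h | rfl
        · rw [hold j h, hold i (hi.trans h)]
          exact hI.disj j h i hi
        · rw [hold i hi, Function.update_self, Nat.add_sub_cancel]
          by_contra hdj
          rw [card_eq_zero, filter_eq_empty_iff] at hE1
          exact hE1 (mem_range.2 (by omega)) ⟨(hI.mem i hi).1, hdj⟩
      · exact hlog m (hpot1.trans hI.potential)
      · have h1 : (deficit n NX NY G C Ab (Function.update c m (X + 1)) : ℝ) =
            deficit n NX NY G C Ab c - gain n NX NY G C Ab c X := by
          rw [← hdef]; push_cast; ring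
        have h2 : (deficit n NX NY G C Ab c : ℝ) ≤ C * wanting n NX NY G C Ab c := by
          exact_mod_cast deficit_le
        have h3 : (wanting n NX NY G C Ab c : ℝ) ≤ 2 * G * gain n NX NY G C Ab c X := by
          exact_mod_cast not_lt.1 hE3
        have h4 : (deficit n NX NY G C Ab c : ℝ) / (2 * G * C) ≤ gain n NX NY G C Ab c X := by
          rw [div_le_iff₀ hGC]
          calc _ ≤ (C : ℝ) * wanting n NX NY G C Ab c := h2
            _ ≤ C * (2 * G * gain n NX NY G C Ab c X) := by gcongr
            _ = _ := by ring
        have h5 : (0 : ℝ) ≤ 1 - 1 / (2 * G * C) := by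
          rw [sub_nonneg, div_le_one hGC]
          have : (1 : ℝ) ≤ G := by exact_mod_cast hG
          have : (1 : ℝ) ≤ C := by exact_mod_cast hC
          nlinarith
        calc (deficit n NX NY G C Ab (Function.update c m (X + 1)) : ℝ)
            ≤ deficit n NX NY G C Ab c - deficit n NX NY G C Ab c / (2 * G * C) := by
              rw [h1]; linarith
          _ = (1 - 1 / (2 * G * C)) * deficit n NX NY G C Ab c := by ring
          _ ≤ (1 - 1 / (2 * G * C)) * ((1 - 1 / (2 * G * C)) ^ m * (C * NY)) := by
              gcongr; exact hI.potential
          _ = _ := by ring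

open Classical in
/-- The greedy selection hits every rich `Y` at least `C` times. -/
theorem run_spec {D M : ℕ} (hNX : 0 < NX) (hG : 0 < G) (hC : 0 < C)
    (hD : ∀ X < NX, #{X' ∈ range NX | ¬ Dj X X'} * n ≤ D * NX)
    (hM : 2 * G * D * M ≤ n) (hMn : M < n)
    (hlog : ∀ m : ℕ, (1 : ℝ) ≤ (1 - 1 / (2 * G * C)) ^ m * (C * NY) → m + 1 ≤ M) :
    ∃ m ≤ M, (∀ i, m ≤ i → run n NX NY G C Ab Dj n i = 0) ∧
      (∀ i < m, 0 < run n NX NY G C Ab Dj n i ∧ run n NX NY G C Ab Dj n i - 1 < NX ∧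
        ∃ Y < NY, Ab (run n NX NY G C Ab Dj n i - 1) Y) ∧
      (∀ j < m, ∀ i < j, Dj (run n NX NY G C Ab Dj n i - 1) (run n NX NY G C Ab Dj n j - 1)) ∧
      ∀ Y < NY, Rich NX G Ab Y → C ≤ hits n Ab (run n NX NY G C Ab Dj n) Y := by
  obtain ⟨m, hI⟩ := inv_run (Ab := Ab) hNX hG hC hD hM hlog n le_rfl
  refine ⟨m, hI.le_bound, hI.zero, hI.mem, hI.disj, fun Y hY hR => ?_⟩
  -- There are `n` rounds but at most `M < n` successes, so the selection has stopped for want of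
  -- anything to hit.
  have hW := hI.finished.resolve_left (by have := hI.le_bound; omega)
  by_contra hlt
  unfold wanting at hW
  rw [card_eq_zero, filter_eq_empty_iff] at hW
  exact hW (mem_range.2 hY) ⟨by omega, hR⟩

end Greedy

/-! ### Counting absorbing tuples -/

namespace KGraph

variable {k : ℕ} {V : Type*} [DecidableEq V]

theorem hasPerfectMatchingOn_empty (H : KGraph k V) : H.HasPerfectMatchingOn ∅ :=
  ⟨∅, by simp, by simp, by simp⟩

theorem hasPerfectMatchingOn_of_mem (H : KGraph k V) {e : Finset V} (he : e ∈ H.edges) :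
    H.HasPerfectMatchingOn e :=
  ⟨{e}, by simp [inducedEdges, he], by simp, by simp⟩

theorem HasPerfectMatchingOn.union {H : KGraph k V} {A B : Finset V}
    (hA : H.HasPerfectMatchingOn A) (hB : H.HasPerfectMatchingOn B) (hAB : Disjoint A B) :
    H.HasPerfectMatchingOn (A ∪ B) := by
  obtain ⟨M, hM, hMd, hMu⟩ := hA
  obtain ⟨N, hN, hNd, hNu⟩ := hB
  have sub : ∀ {M W}, M ⊆ H.inducedEdges W → ∀ e ∈ M, e ∈ H.edges ∧ e ⊆ W := fun h e he => by
    simpa [inducedEdges] using h he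
  refine ⟨M ∪ N, fun e he => ?_, ?_, ?_⟩
  · simp only [inducedEdges, mem_filter]
    rcases mem_union.1 he with h | h
    · exact ⟨(sub hM e h).1, (sub hM e h).2.trans subset_union_left⟩
    · exact ⟨(sub hN e h).1, (sub hN e h).2.trans subset_union_right⟩
  · intro e he f hf hef
    simp only [coe_union, Set.mem_union, mem_coe] at he hf
    rcases he with he | he <;> rcases hf with hf | hf
    · exact hMd he hf hef
    · exact hAB.mono (sub hM e he).2 (sub hN f hf).2
    · exact (hAB.mono (sub hM f hf).2 (sub hN e he).2).symm
    · exact hNd he hf hef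
  · ext v
    simp only [mem_biUnion, mem_union, ← hMu, ← hNu]
    constructor
    · rintro ⟨e, he | he, hv⟩
      · exact Or.inl ⟨e, he, hv⟩
      · exact Or.inr ⟨e, he, hv⟩
    · rintro (⟨e, he, hv⟩ | ⟨e, he, hv⟩)
      · exact ⟨e, Or.inl he, hv⟩
      · exact ⟨e, Or.inr he, hv⟩

theorem hasPerfectMatchingOn_biUnion {H : KGraph k V} {ι : Type*} [DecidableEq ι]
    (I : Finset ι) (W : ι → Finset V) (hW : ∀ i ∈ I, H.HasPerfectMatchingOn (W i))
    (hd : ∀ i ∈ I, ∀ j ∈ I, i ≠ j → Disjoint (W i) (W j)) :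
    H.HasPerfectMatchingOn (I.biUnion W) := by
  induction I using Finset.induction_on with
  | empty => simpa using H.hasPerfectMatchingOn_empty
  | insert i I hi ih =>
    rw [biUnion_insert]
    refine (hW i (mem_insert_self _ _)).union
      (ih (fun j hj => hW j (mem_insert_of_mem hj))
        fun j hj l hl => hd j (mem_insert_of_mem hj) l (mem_insert_of_mem hl)) ?_
    rw [disjoint_biUnion_right]
    exact fun j hj => hd i (mem_insert_self _ _) j (mem_insert_of_mem hj) (by
      rintro rfl; exact hi hj)

/-- A perfect matching of the vertices of an injective tuple is a reordering of the tuple in which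
the consecutive `k`-blocks are edges. -/
theorem hasPerfectMatchingOn_image_iff (H : KGraph k V) (hk : 0 < k) {m : ℕ}
    (z : Fin (m * k) → V) (hz : Function.Injective z) :
    H.HasPerfectMatchingOn (univ.image z) ↔ ∃ σ : Equiv.Perm (Fin (m * k)), ∀ b : Fin m,
      univ.image (fun j : Fin k => z (σ (finProdFinEquiv (b, j)))) ∈ H.edges := by
  constructor
  · rintro ⟨M, hM, hMd, hMu⟩
    have sub : ∀ e ∈ M, e ∈ H.edges ∧ e ⊆ univ.image z := fun e he => by
      simpa only [inducedEdges, mem_filter] using hM he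
    have hcard : #M = m := by
      have h1 : #(M.biUnion id) = ∑ e ∈ M, #e := card_biUnion hMd
      rw [hMu, card_image_of_injective _ hz, card_univ, Fintype.card_fin,
        sum_congr rfl fun e he => H.uniform e (sub e he).1, sum_const, smul_eq_mul] at h1
      exact (Nat.eq_of_mul_eq_mul_right hk h1).symm
    -- Number the matching edges and list the vertices of each. Sending `(b, j)` to the position in
    -- `z` of the `j`-th vertex of the `b`-th edge is injective, as the edges are disjoint, hence a
    -- permutation by cardinality.
    let f : Fin m ≃ M := (M.equivFinOfCardEq hcard).symm
    let g : ∀ b : Fin m, Fin k ≃ (f b : Finset V) := fun b =>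
      ((f b : Finset V).equivFinOfCardEq (H.uniform _ (sub _ (f b).2).1)).symm
    have hg : ∀ q : Fin m × Fin k, ∃ i, z i = g q.1 q.2 := fun q => by
      simpa using (sub _ (f q.1).2).2 (g q.1 q.2).2
    choose h hh using hg
    have hinj : Function.Injective h := by
      rintro ⟨b, j⟩ ⟨b', j'⟩ heq
      have h1 : (g b j : V) = g b' j' := by
        rw [← hh (b, j), ← hh (b', j'), heq]
      have hb : b = b' := by
        by_contra hne
        have hd := hMd (f b).2 (f b').2 fun he => hne (f.injective (Subtype.ext he))
        exact disjoint_left.1 hd (g b j).2 (h1 ▸ (g b' j').2)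
      subst hb
      rw [(g b).injective (Subtype.ext h1)]
    let σ : Equiv.Perm (Fin (m * k)) := Equiv.ofBijective (h ∘ finProdFinEquiv.symm)
      (Finite.injective_iff_bijective.1 (hinj.comp finProdFinEquiv.symm.injective))
    refine ⟨σ, fun b => ?_⟩
    have : univ.image (fun j : Fin k => z (σ (finProdFinEquiv (b, j)))) = (f b : Finset V) := by
      have h1 : ∀ j, z (σ (finProdFinEquiv (b, j))) = g b j := fun j => by
        simp [σ, hh]
      simp only [h1]
      ext v
      simp only [mem_image, mem_univ, true_and]
      constructor
      · rintro ⟨j, rfl⟩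
        exact (g b j).2
      · intro hv
        exact ⟨(g b).symm ⟨v, hv⟩, by simp⟩
    rw [this]
    exact (sub _ (f b).2).1
  · rintro ⟨σ, hσ⟩
    have : univ.image z = univ.biUnion fun b : Fin m =>
        univ.image (fun j : Fin k => z (σ (finProdFinEquiv (b, j)))) := by
      ext v
      simp only [mem_image, mem_biUnion, mem_univ, true_and]
      constructor
      · rintro ⟨i, rfl⟩
        exact ⟨(finProdFinEquiv.symm (σ.symm i)).1, (finProdFinEquiv.symm (σ.symm i)).2, by
          rw [Prod.mk.eta, Equiv.apply_symm_apply, Equiv.apply_symm_apply]⟩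
      · rintro ⟨b, j, rfl⟩
        exact ⟨_, rfl⟩
    rw [this]
    refine hasPerfectMatchingOn_biUnion _ _ (fun b _ => H.hasPerfectMatchingOn_of_mem (hσ b)) ?_
    intro b _ b' _ hbb
    rw [disjoint_left]
    simp only [mem_image, mem_univ, true_and, not_exists]
    rintro _ ⟨j, rfl⟩ j' h
    have := finProdFinEquiv.injective (σ.injective (hz h))
    exact hbb (Prod.ext_iff.1 this).1.symm

/-! ### Absorption by tuples, and the scarcity of degenerate tuples. -/

/-- The tuple `x` absorbs the tuple `y`. -/
def AbsorbsTuple (H : KGraph k V) {ι κ : Type*} [Fintype ι] [Fintype κ] (x : ι → V) (y : κ → V) :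
    Prop :=
  Function.Injective (Sum.elim x y) ∧ H.HasPerfectMatchingOn (univ.image x) ∧
    H.HasPerfectMatchingOn (univ.image x ∪ univ.image y)

theorem AbsorbsTuple.comp_equiv {H : KGraph k V} {ι ι' κ : Type*} [Fintype ι] [Fintype ι']
    [Fintype κ] (e : ι' ≃ ι) (x : ι → V) (y : κ → V) :
    H.AbsorbsTuple (x ∘ e) y ↔ H.AbsorbsTuple x y := by
  have h1 : univ.image (x ∘ e) = univ.image x := by
    ext v
    simp only [mem_image, mem_univ, true_and, Function.comp]
    exact ⟨fun ⟨i, h⟩ => ⟨e i, h⟩, fun ⟨i, h⟩ => ⟨e.symm i, by simpa using h⟩⟩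
  have h2 : Sum.elim (x ∘ e) y = Sum.elim x y ∘ (Equiv.sumCongr e (Equiv.refl κ)) := by
    ext i; cases i <;> rfl
  unfold AbsorbsTuple
  rw [h1, h2, Equiv.injective_comp]

/-- Tuples that are determined by their entries other than the one at `a` are few. -/
theorem card_le_of_determined {V : Type*} [Fintype V] {ι : Type*} [Fintype ι] [DecidableEq ι] (a : ι)
    (P : Finset (ι → V)) (h : ∀ x ∈ P, ∀ x' ∈ P, (∀ i ≠ a, x i = x' i) → x a = x' a) :
    #P ≤ Fintype.card V ^ (Fintype.card ι - 1) := by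
  have : Fintype.card ({i // i ≠ a} → V) = Fintype.card V ^ (Fintype.card ι - 1) := by
    rw [Fintype.card_fun, Fintype.card_subtype_compl, Fintype.card_subtype_eq]
  rw [← this, ← card_univ]
  refine card_le_card_of_injOn (fun x i => x i) (fun _ _ => mem_univ _) fun x hx x' hx' hxx => ?_
  have h1 : ∀ i ≠ a, x i = x' i := fun i hi => congrFun hxx ⟨i, hi⟩
  funext i
  by_cases hi : i = a
  · subst hi; exact h x hx x' hx' h1
  · exact h1 i hi

open Classical in
/-- Few tuples meet a given tuple. -/
theorem card_meet_le [Fintype V] {ι κ : Type*} [Fintype ι] [Fintype κ] (y : κ → V) :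
    #{x : ι → V | ∃ i j, x i = y j} ≤
      Fintype.card ι * Fintype.card κ * Fintype.card V ^ (Fintype.card ι - 1) := by
  have hsub : ({x : ι → V | ∃ i j, x i = y j} : Finset (ι → V)) ⊆
      (univ : Finset (ι × κ)).biUnion fun q => {x : ι → V | x q.1 = y q.2} := by
    intro x hx
    obtain ⟨i, j, h⟩ := (mem_filter.1 hx).2
    simp only [mem_biUnion, mem_univ, true_and, mem_filter]
    exact ⟨(i, j), h⟩
  calc _ ≤ _ := card_le_card hsub
    _ ≤ #(univ : Finset (ι × κ)) * Fintype.card V ^ (Fintype.card ι - 1) := by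
        refine card_biUnion_le_card_mul _ _ _ fun q _ => card_le_of_determined q.1 _ ?_
        intro x hx x' hx' _
        rw [(mem_filter.1 hx).2, (mem_filter.1 hx').2]
    _ = _ := by rw [card_univ, Fintype.card_prod]

open Classical in
/-- Few tuples fail to be injective. -/
theorem card_not_injective_le [Fintype V] {ι : Type*} [Fintype ι] :
    #{x : ι → V | ¬ Function.Injective x} ≤
      Fintype.card ι * Fintype.card ι * Fintype.card V ^ (Fintype.card ι - 1) := by
  have hsub : ({x : ι → V | ¬ Function.Injective x} : Finset (ι → V)) ⊆
      (univ : Finset (ι × ι)).biUnion fun q => {x : ι → V | x q.1 = x q.2 ∧ q.1 ≠ q.2} := by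
    intro x hx
    have hx := (mem_filter.1 hx).2
    rw [Function.not_injective_iff] at hx
    obtain ⟨i, j, h⟩ := hx
    simp only [mem_biUnion, mem_univ, true_and, mem_filter]
    exact ⟨(i, j), h⟩
  calc _ ≤ _ := card_le_card hsub
    _ ≤ #(univ : Finset (ι × ι)) * Fintype.card V ^ (Fintype.card ι - 1) := by
        refine card_biUnion_le_card_mul _ _ _ fun q _ => card_le_of_determined q.1 _ ?_
        intro x hx x' hx' h
        have h1 := (mem_filter.1 hx).2
        rw [h1.1, (mem_filter.1 hx').2.1, h _ h1.2.symm]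
    _ = _ := by rw [card_univ, Fintype.card_prod]

/-! ### Edges and connectors for a robust index vector. -/

/-- Equal index vectors give fibres of equal size over each part; bijections between the fibres glue
to an enumeration of `e` that respects the labels. -/
theorem exists_reordering [Fintype V] {d : ℕ} (p : V → Fin d) {e : Finset V} (y : Fin k → V)
    (hy : Function.Injective y)
    (h : indexVector p e = indexVector p (univ.image y)) :
    ∃ x : Fin k → V, univ.image x = e ∧ ∀ j, p (x j) = p (y j) := by
  have hfib : ∀ c, Nonempty ({j // p (y j) = c} ≃ {v : e // p v = c}) := by
    intro c
    refine ⟨Fintype.equivOfCardEq ?_⟩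
    have h1 : #(e ∩ part p c) = #(univ.image y ∩ part p c) := by
      have := congrFun h c
      simpa [indexVector] using this
    rw [Fintype.card_subtype, Fintype.card_subtype]
    have h2 : #{v : e | p v = c} = #(e ∩ part p c) := by
      rw [← card_map (Function.Embedding.subtype _)]
      congr 1
      ext v
      simp [part, and_comm]
    have h3 : #{j | p (y j) = c} = #(univ.image y ∩ part p c) := by
      rw [← card_image_of_injective _ hy]
      congr 1
      ext v
      simp only [mem_image, mem_filter, mem_univ, true_and, part, mem_inter]
      constructor
      · rintro ⟨j, hj, rfl⟩; exact ⟨⟨j, rfl⟩, hj⟩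
      · rintro ⟨⟨j, rfl⟩, hj⟩; exact ⟨j, hj, rfl⟩
    rw [h2, h3, h1]
  let E : Fin k ≃ e := Equiv.ofFiberEquiv (f := fun j => p (y j)) (g := fun v : e => p v)
    fun c => (hfib c).some
  refine ⟨fun j => E j, ?_, fun j => ?_⟩
  · ext v
    simp only [mem_image, mem_univ, true_and]
    exact ⟨by rintro ⟨j, rfl⟩; exact (E j).2, fun hv => ⟨E.symm ⟨v, hv⟩, by simp⟩⟩
  · exact Equiv.ofFiberEquiv_map (f := fun j => p (y j)) (g := fun v : e => p v) _ j

open Classical in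
/-- There are many edges with the robust index vector of `y`, ordered so as to match `y`, and with
no vertex at the same position as in `y`. -/
theorem card_matching_edges [Fintype V] (H : KGraph k V) {d : ℕ} (p : V → Fin d) {μ : ℝ}
    (y : Fin k → V) (hy : Function.Injective y)
    (hrob : indexVector p (univ.image y) ∈ H.robustVectors p μ)
    (hn : (k : ℝ) * Fintype.card V ^ (k - 1) ≤ μ / 2 * Fintype.card V ^ k) :
    μ / 2 * (Fintype.card V : ℝ) ^ k ≤
      #{e : Fin k → V | univ.image e ∈ H.edges ∧ ∀ j, p (e j) = p (y j) ∧ e j ≠ y j} := by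
  have h1 : #{e ∈ H.edges | indexVector p e = indexVector p (univ.image y)} ≤
      #{e : Fin k → V | univ.image e ∈ H.edges ∧ ∀ j, p (e j) = p (y j)} := by
    refine (card_le_card (t := image (fun x : Fin k → V => univ.image x) _) ?_).trans
      card_image_le
    intro e he
    obtain ⟨heH, hei⟩ := mem_filter.1 he
    obtain ⟨x, rfl, hx⟩ := exists_reordering p y hy hei
    exact mem_image_of_mem _ (mem_filter.2 ⟨mem_univ _, heH, hx⟩)
  -- Closedness concerns distinct vertices only, so orderings with `e j = y j` for some `j` are
  -- discarded; by `hn` they cost at most half of the count.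
  have h2 : #{e : Fin k → V | univ.image e ∈ H.edges ∧ ∀ j, p (e j) = p (y j)} ≤
      #{e : Fin k → V | univ.image e ∈ H.edges ∧ ∀ j, p (e j) = p (y j) ∧ e j ≠ y j} +
        k * Fintype.card V ^ (k - 1) := by
    have hB : #((univ : Finset (Fin k)).biUnion fun j => {e : Fin k → V | e j = y j}) ≤
        k * Fintype.card V ^ (k - 1) := by
      have := card_biUnion_le_card_mul (univ : Finset (Fin k))
        (fun j => ({e : Fin k → V | e j = y j} : Finset (Fin k → V)))
        (Fintype.card V ^ (k - 1)) fun j _ => by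
          have := card_le_of_determined j ({e : Fin k → V | e j = y j} : Finset (Fin k → V))
            fun x hx x' hx' _ => by rw [(mem_filter.1 hx).2, (mem_filter.1 hx').2]
          rwa [Fintype.card_fin] at this
      rwa [card_univ, Fintype.card_fin] at this
    refine (card_le_card fun e he => ?_).trans ((card_union_le _ _).trans
      (Nat.add_le_add_left hB _))
    obtain ⟨_, h1, h2⟩ := mem_filter.1 he
    by_cases h : ∀ j, e j ≠ y j
    · exact mem_union_left _ (mem_filter.2 ⟨mem_univ _, h1, fun j => ⟨h2 j, h j⟩⟩)
    · push Not at h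
      obtain ⟨j, hj⟩ := h
      exact mem_union_right _ (mem_biUnion.2 ⟨j, mem_univ _, mem_filter.2 ⟨mem_univ _, hj⟩⟩)
  have h3 := hrob.2.2
  have h4 := (Nat.cast_le (α := ℝ)).2 (h1.trans h2)
  push_cast at h4
  linarith

open Classical in
/-- The enumerations of the sets that connect `u` and `v`. -/
noncomputable def connectors [Fintype V] (H : KGraph k V) (N : ℕ) (u v : V) :
    Finset (Fin N → V) :=
  {x | H.HasPerfectMatchingOn (insert u (univ.image x)) ∧
    H.HasPerfectMatchingOn (insert v (univ.image x))}

/-- Every connecting set has at least one enumeration, so passing from sets to tuples keeps the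
lower bound. -/
theorem Reachable.card_connectors [Fintype V] {H : KGraph k V} {β : ℝ} {t : ℕ} {u v : V}
    (h : H.Reachable β t u v) :
    β * (Fintype.card V : ℝ) ^ (t * k - 1) ≤ #(H.connectors (t * k - 1) u v) := by
  classical
  refine h.trans (Nat.cast_le.2 ?_)
  refine (card_le_card (t := image (fun x : Fin (t * k - 1) → V => univ.image x) _) ?_).trans
    card_image_le
  intro S hS
  simp only [mem_filter, mem_powersetCard] at hS
  obtain ⟨⟨_, hc⟩, hu, hv⟩ := hS
  have hS : univ.image (fun i => ((S.equivFinOfCardEq hc).symm i : V)) = S := by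
    ext w
    simp only [mem_image, mem_univ, true_and]
    exact ⟨by rintro ⟨i, rfl⟩; exact ((S.equivFinOfCardEq hc).symm i).2,
      fun hw => ⟨S.equivFinOfCardEq hc ⟨w, hw⟩, by simp⟩⟩
  refine mem_image.2 ⟨_, mem_filter.2 ⟨mem_univ _, ?_, ?_⟩, hS⟩
  · rw [hS]; convert hu
  · rw [hS]; convert hv

/-- An edge that matches `y`, with connectors between corresponding vertices, absorbs `y`. -/
theorem absorbsTuple_of_connectors [Fintype V] {H : KGraph k V} {N : ℕ}
    (x : Fin k ⊕ Fin k × Fin N → V) (y : Fin k → V) (hinj : Function.Injective (Sum.elim x y))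
    (he : univ.image (fun j => x (.inl j)) ∈ H.edges)
    (hx : ∀ j, (fun i => x (.inr (j, i))) ∈ H.connectors N (x (.inl j)) (y j)) :
    H.AbsorbsTuple x y := by
  have hx' : ∀ j, H.HasPerfectMatchingOn
      (insert (x (.inl j)) (univ.image fun i => x (.inr (j, i)))) ∧
      H.HasPerfectMatchingOn (insert (y j) (univ.image fun i => x (.inr (j, i)))) := fun j => by
    simpa [connectors] using hx j
  have hxi : Function.Injective x := fun a b h => by
    simpa using @hinj (.inl a) (.inl b) h
  have hyi : Function.Injective y := fun a b h => by
    simpa using @hinj (.inr a) (.inr b) h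
  have hxy : ∀ a b, x a ≠ y b := fun a b h => by
    simpa using @hinj (.inl a) (.inr b) h
  have e1 : univ.image x = univ.biUnion fun j =>
      insert (x (.inl j)) (univ.image fun i => x (.inr (j, i))) := by
    ext v
    simp only [mem_image, mem_univ, true_and, mem_biUnion, mem_insert]
    constructor
    · rintro ⟨j | ⟨j, i⟩, rfl⟩
      · exact ⟨j, Or.inl rfl⟩
      · exact ⟨j, Or.inr ⟨i, rfl⟩⟩
    · rintro ⟨j, rfl | ⟨i, rfl⟩⟩ <;> exact ⟨_, rfl⟩
  -- Exchange each edge vertex for the corresponding `y j`: the blocks stay matchable, and the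
  -- released vertices form the edge itself.
  have e2 : univ.image x ∪ univ.image y = (univ.biUnion fun j =>
      insert (y j) (univ.image fun i => x (.inr (j, i)))) ∪ univ.image (fun j => x (.inl j)) := by
    ext v
    simp only [mem_image, mem_univ, true_and, mem_biUnion, mem_insert, mem_union]
    constructor
    · rintro (⟨j | ⟨j, i⟩, rfl⟩ | ⟨j, rfl⟩)
      · exact Or.inr ⟨j, rfl⟩
      · exact Or.inl ⟨j, Or.inr ⟨i, rfl⟩⟩
      · exact Or.inl ⟨j, Or.inl rfl⟩
    · rintro (⟨j, rfl | ⟨i, rfl⟩⟩ | ⟨j, rfl⟩)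
      · exact Or.inr ⟨_, rfl⟩
      · exact Or.inl ⟨_, rfl⟩
      · exact Or.inl ⟨_, rfl⟩
  refine ⟨hinj, ?_, ?_⟩
  · rw [e1]
    refine hasPerfectMatchingOn_biUnion _ _ (fun j _ => (hx' j).1) fun j _ j' _ hjj => ?_
    rw [disjoint_left]
    simp only [mem_insert, mem_image, mem_univ, true_and]
    rintro v (rfl | ⟨i, rfl⟩) (h | ⟨i', h⟩) <;> have := hxi h <;> simp at this
    · exact hjj this
    · exact hjj this.1.symm
  · rw [e2]
    refine (hasPerfectMatchingOn_biUnion _ _ (fun j _ => (hx' j).2) fun j _ j' _ hjj => ?_).union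
      (H.hasPerfectMatchingOn_of_mem he) ?_
    · rw [disjoint_left]
      simp only [mem_insert, mem_image, mem_univ, true_and]
      rintro v (rfl | ⟨i, rfl⟩) (h | ⟨i', h⟩)
      · exact hjj (hyi h)
      · exact hxy _ _ h
      · exact hxy _ _ h
      · have := hxi h
        simp at this
        exact hjj this.1.symm
    · rw [disjoint_left]
      simp only [mem_insert, mem_image, mem_univ, true_and, mem_biUnion]
      rintro v ⟨j, rfl | ⟨i, rfl⟩⟩ ⟨j', h⟩
      · exact hxy _ _ h
      · have := hxi h
        simp at this

open Classical in
-- There are `μ / 2 * n ^ k` ordered edges, and independently for each of the `k` positions `β * n ^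
-- (t k - 1)` connectors. This gives `μ * β ^ k / 2` of all `s`-tuples; half of that pays for
-- repeated vertices and meetings with `y`.
theorem card_absorbsTuple [Fintype V] (H : KGraph k V) {d t : ℕ} (p : V → Fin d) {β μ : ℝ}
    (hβ : 0 < β) (hcl : ∀ j, H.ClosedIn β t (part p j))
    (y : Fin k → V) (hy : Function.Injective y)
    (hrob : indexVector p (univ.image y) ∈ H.robustVectors p μ) {s : ℕ}
    (hs : k + k * (t * k - 1) = s)
    (hn : (k : ℝ) * Fintype.card V ^ (k - 1) ≤ μ / 2 * Fintype.card V ^ k)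
    (hn' : ((s * s + s * k : ℕ) : ℝ) * Fintype.card V ^ (s - 1) ≤
      μ * β ^ k / 4 * Fintype.card V ^ s) :
    μ * β ^ k / 4 * (Fintype.card V : ℝ) ^ s ≤ #{x : Fin s → V | H.AbsorbsTuple x y} := by
  set N := t * k - 1 with hN
  set E : Finset (Fin k → V) :=
    {e | univ.image e ∈ H.edges ∧ ∀ j, p (e j) = p (y j) ∧ e j ≠ y j} with hE
  have hEcard := card_matching_edges H p y hy hrob hn
  rw [← hE] at hEcard
  have hι : Fintype.card (Fin k ⊕ Fin k × Fin N) = s := by simp [hs]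
  -- configurations
  set A : Finset (Fin k ⊕ Fin k × Fin N → V) := {x | (fun j => x (.inl j)) ∈ E ∧
    ∀ j, (fun i => x (.inr (j, i))) ∈ H.connectors N (x (.inl j)) (y j)} with hA
  have hAcard : μ / 2 * β ^ k * (Fintype.card V : ℝ) ^ s ≤ #A := by
    have h1 : ∑ e ∈ E, ∏ j, #(H.connectors N (e j) (y j)) ≤ #A := by
      have : ∑ e ∈ E, ∏ j, #(H.connectors N (e j) (y j)) =
          #(E.sigma fun e => Fintype.piFinset fun j => H.connectors N (e j) (y j)) := by
        rw [card_sigma]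
        simp
      rw [this]
      refine card_le_card_of_injOn
        (fun q : (_ : Fin k → V) × (Fin k → Fin N → V) => Sum.elim q.1 fun r => q.2 r.1 r.2) ?_ ?_
      · rintro ⟨e, u⟩ hq
        simp only [coe_sigma, Set.mem_sigma_iff, mem_coe, Fintype.mem_piFinset] at hq
        simp only [hA, coe_filter, Set.mem_ofPred_eq, mem_univ, true_and, Sum.elim_inl, Sum.elim_inr]
        exact hq
      · rintro ⟨e, u⟩ _ ⟨e', u'⟩ _ h
        have h1 : e = e' := funext fun j => congrFun h (.inl j)
        have h2 : u = u' := funext fun j => funext fun i => congrFun h (.inr (j, i))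
        rw [h1, h2]
    have h2 : ∀ e ∈ E, (β * (Fintype.card V : ℝ) ^ N) ^ k ≤
        ((∏ j, #(H.connectors N (e j) (y j)) : ℕ) : ℝ) := by
      intro e he
      have he := (mem_filter.1 he).2.2
      push_cast
      calc (β * (Fintype.card V : ℝ) ^ N) ^ k = ∏ _j : Fin k, β * (Fintype.card V : ℝ) ^ N := by
            simp
        _ ≤ _ := prod_le_prod (fun _ _ => by positivity) fun j _ =>
            Reachable.card_connectors (hcl (p (y j)) (e j) (by simp [part, (he j).1]) (y j)
              (by simp [part]) (he j).2)
    calc μ / 2 * β ^ k * (Fintype.card V : ℝ) ^ s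
        = (μ / 2 * (Fintype.card V : ℝ) ^ k) * (β * (Fintype.card V : ℝ) ^ N) ^ k := by
          rw [← hs, mul_pow, pow_add, ← pow_mul, mul_comm k N]; ring
      _ ≤ #E * (β * (Fintype.card V : ℝ) ^ N) ^ k := by gcongr
      _ = ∑ _e ∈ E, (β * (Fintype.card V : ℝ) ^ N) ^ k := by rw [sum_const, nsmul_eq_mul]
      _ ≤ ∑ e ∈ E, ((∏ j, #(H.connectors N (e j) (y j)) : ℕ) : ℝ) := sum_le_sum h2
      _ ≤ #A := by exact_mod_cast h1
  -- degenerate configurations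
  have hbad : #A ≤ #{x : Fin k ⊕ Fin k × Fin N → V | H.AbsorbsTuple x y} +
      (s * s + s * k) * Fintype.card V ^ (s - 1) := by
    have b1 := card_not_injective_le (V := V) (ι := Fin k ⊕ Fin k × Fin N)
    have b2 := card_meet_le (ι := Fin k ⊕ Fin k × Fin N) y
    rw [hι] at b1 b2
    rw [Fintype.card_fin] at b2
    rw [add_mul]
    refine (card_le_card (t := _ ∪ (_ ∪ _)) fun x hx => ?_).trans ((card_union_le _ _).trans
      (Nat.add_le_add_left ((card_union_le _ _).trans (Nat.add_le_add b1 b2)) _))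
    obtain ⟨_, hxE, hxc⟩ := mem_filter.1 hx
    simp only [mem_union, mem_filter, mem_univ, true_and]
    by_cases h1 : Function.Injective x
    · by_cases h2 : ∃ i j, x i = y j
      · exact Or.inr (Or.inr h2)
      · push Not at h2
        refine Or.inl (absorbsTuple_of_connectors x y (h1.sumElim hy h2)
          (mem_filter.1 hxE).2.1 hxc)
    · exact Or.inr (Or.inl h1)
  have htrans : #{x : Fin k ⊕ Fin k × Fin N → V | H.AbsorbsTuple x y} =
      #{x : Fin s → V | H.AbsorbsTuple x y} := by
    let e : Fin s ≃ Fin k ⊕ Fin k × Fin N := Fintype.equivOfCardEq (by rw [hι, Fintype.card_fin])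
    refine card_bij (fun x _ => x ∘ e) (fun x hx => ?_) (fun x _ x' _ h => ?_) fun x hx => ?_
    · simpa [AbsorbsTuple.comp_equiv] using hx
    · exact e.surjective.injective_comp_right h
    · refine ⟨x ∘ e.symm, ?_, by ext; simp⟩
      simpa [AbsorbsTuple.comp_equiv] using hx
  rw [htrans] at hbad
  have hbad' := (Nat.cast_le (α := ℝ)).2 hbad
  push_cast at hbad' hn'
  linarith

end KGraph

/-! ### Evaluating tests -/

namespace WordRAM

namespace Expr

theorem eval_lt (w n : ℕ) (mem : ℕ → ℕ) (e : Expr) (env : ℕ → ℕ) : e.eval w n mem env < 2 ^ w := by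
  have h : 0 < 2 ^ w := by positivity
  cases e <;> exact Nat.mod_lt _ h

/-- The expression `e` has the value `1` or `0` according to whether `P` holds. -/
def Tests (w n : ℕ) (mem env : ℕ → ℕ) (e : Expr) (P : Prop) : Prop :=
  (P → e.eval w n mem env = 1) ∧ (¬ P → e.eval w n mem env = 0)

/-- Conjunction. -/
def and (a b : Expr) : Expr := .op .mul a b

/-- Negation. -/
def not (a : Expr) : Expr := .op .eq a (.num 0)

/-- The conjunction of the tests `f x` for `x` in a list. -/
def all {α : Type*} (f : α → Expr) : List α → Expr
  | [] => .num 1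
  | x :: l => and (f x) (all f l)

/-- The disjunction of the tests `f x` for `x` in a list. -/
def any {α : Type*} (f : α → Expr) (l : List α) : Expr := not (all (fun x => not (f x)) l)

/-- The sum of the values of `f x` for `x` in a list. -/
def listSum {α : Type*} (f : α → Expr) : List α → Expr
  | [] => .num 0
  | x :: l => .op .add (f x) (listSum f l)

/-- The power `n ^ j` of the size. -/
def pow : ℕ → Expr
  | 0 => .num 1
  | j + 1 => .op .mul (pow j) .size

/-- The digit of weight `n ^ i` of `X`. -/
def digit (i : ℕ) (X : Expr) : Expr := .op .mod (.op .div X (pow i)) .size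

variable {w n : ℕ} {mem env : ℕ → ℕ}

theorem Tests.congr {e : Expr} {P Q : Prop} (h : Tests w n mem env e P) (hPQ : P ↔ Q) :
    Tests w n mem env e Q :=
  ⟨fun hQ => h.1 (hPQ.2 hQ), fun hQ => h.2 fun hP => hQ (hPQ.1 hP)⟩

/-- Conjunction is a product, so where `P` fails the value of `b` is irrelevant and `b` need be
correct only under `P`. The matching tests use this, as they are valid for distinct vertices only.
-/
theorem Tests.and (hw : 1 < 2 ^ w) {a b : Expr} {P Q : Prop} (ha : Tests w n mem env a P)
    (hb : P → Tests w n mem env b Q) : Tests w n mem env (and a b) (P ∧ Q) := by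
  constructor
  · rintro ⟨hP, hQ⟩
    simp only [Expr.and, eval, BinOp.eval, ha.1 hP, (hb hP).1 hQ]
    exact Nat.mod_eq_of_lt hw
  · intro h
    by_cases hP : P
    · simp [Expr.and, eval, BinOp.eval, (hb hP).2 fun hQ => h ⟨hP, hQ⟩]
    · simp [Expr.and, eval, BinOp.eval, ha.2 hP]

theorem Tests.eq (hw : 1 < 2 ^ w) {a b : Expr} {x y : ℕ} (ha : a.eval w n mem env = x)
    (hb : b.eval w n mem env = y) : Tests w n mem env (.op .eq a b) (x = y) := by
  constructor <;> intro h <;> simp only [eval, BinOp.eval, ha, hb, h, if_true, if_false]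
  · exact Nat.mod_eq_of_lt hw
  · exact Nat.zero_mod _

theorem Tests.lt (hw : 1 < 2 ^ w) {a b : Expr} {x y : ℕ} (ha : a.eval w n mem env = x)
    (hb : b.eval w n mem env = y) : Tests w n mem env (.op .lt a b) (x < y) := by
  constructor <;> intro h <;> simp only [eval, BinOp.eval, ha, hb, h, if_true, if_false]
  · exact Nat.mod_eq_of_lt hw
  · exact Nat.zero_mod _

theorem Tests.not (hw : 1 < 2 ^ w) {a : Expr} {P : Prop} (ha : Tests w n mem env a P) :
    Tests w n mem env (not a) (¬ P) := by
  refine (Tests.eq (y := 0) hw rfl (by simp [eval])).congr ?_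
  by_cases hP : P
  · simp [hP, ha.1 hP]
  · simp [hP, ha.2 hP]

theorem Tests.all (hw : 1 < 2 ^ w) {α : Type*} {f : α → Expr} {P : α → Prop} {l : List α}
    (h : ∀ x ∈ l, Tests w n mem env (f x) (P x)) :
    Tests w n mem env (all f l) (∀ x ∈ l, P x) := by
  induction l with
  | nil => exact ⟨fun _ => Nat.mod_eq_of_lt hw, by simp⟩
  | cons x l ih =>
    refine ((h x (by simp)).and hw fun _ => ih fun y hy => h y (by simp [hy])).congr ?_
    simp

theorem Tests.any (hw : 1 < 2 ^ w) {α : Type*} {f : α → Expr} {P : α → Prop} {l : List α}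
    (h : ∀ x ∈ l, Tests w n mem env (f x) (P x)) :
    Tests w n mem env (any f l) (∃ x ∈ l, P x) := by
  refine ((Tests.all hw fun x hx => (h x hx).not hw).not hw).congr ?_
  push Not
  rfl

theorem eval_listSum {α : Type*} {f : α → Expr} {g : α → ℕ} {l : List α}
    (h : ∀ x ∈ l, (f x).eval w n mem env = g x % 2 ^ w) :
    (listSum f l).eval w n mem env = (l.map g).sum % 2 ^ w := by
  induction l with
  | nil => rfl
  | cons x l ih =>
    simp only [listSum, eval, BinOp.eval, h x (by simp), ih fun y hy => h y (by simp [hy]),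
      List.map_cons, List.sum_cons]
    exact (Nat.add_mod _ _ _).symm

theorem eval_pow_mod (j : ℕ) : (pow j).eval w n mem env = n ^ j % 2 ^ w := by
  induction j with
  | zero => rfl
  | succ j ih =>
    simp only [pow, eval, BinOp.eval, ih, pow_succ]
    exact (Nat.mul_mod _ _ _).symm

theorem eval_pow {j : ℕ} (hj : n ^ j < 2 ^ w) : (pow j).eval w n mem env = n ^ j := by
  rw [eval_pow_mod, Nat.mod_eq_of_lt hj]

theorem eval_digit [NeZero n] (hn : n < 2 ^ w) {i : ℕ} (hi : n ^ i < 2 ^ w) {X : Expr} {x : ℕ}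
    (hX : X.eval w n mem env = x) :
    (digit i X).eval w n mem env = (Fin.ofNat n (x / n ^ i) : Fin n) := by
  have hx : x < 2 ^ w := hX ▸ eval_lt ..
  simp only [digit, eval, BinOp.eval, eval_pow hi, hX, Fin.val_ofNat]
  rw [Nat.mod_eq_of_lt hn, Nat.mod_eq_of_lt ((Nat.div_le_self _ _).trans_lt hx),
    Nat.mod_eq_of_lt ((Nat.mod_le _ _).trans_lt ((Nat.div_le_self _ _).trans_lt hx))]

/-- Each summand is `0` or `1`, so all partial counts are at most `n ^ j` and nothing overflows. -/
theorem eval_sum_tests {j : ℕ} (hj : n ^ j < 2 ^ w) {e : Expr} {P : ℕ → Prop}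
    {_ : DecidablePred P} (h : ∀ i < n ^ j, Tests w n mem (push i env) e (P i)) :
    (Expr.sum j e).eval w n mem env = #{i ∈ range (n ^ j) | P i} := by
  have h1 : ∑ i ∈ range (n ^ j), e.eval w n mem (push i env) = #{i ∈ range (n ^ j) | P i} := by
    rw [card_filter]
    refine sum_congr rfl fun i hi => ?_
    split_ifs with hP
    · exact (h i (mem_range.1 hi)).1 hP
    · exact (h i (mem_range.1 hi)).2 hP
  rw [eval, Nat.mod_eq_of_lt hj, h1, Nat.mod_eq_of_lt]
  exact ((card_le_card (filter_subset _ _)).trans (card_range _).le).trans_lt hj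

theorem deg_all_le {α : Type*} {f : α → Expr} {D : ℕ} (h : ∀ x, (f x).deg ≤ D) (l : List α) :
    (all f l).deg ≤ D := by
  induction l with
  | nil => exact Nat.zero_le _
  | cons x l ih => exact max_le (h x) ih

theorem deg_any_le {α : Type*} {f : α → Expr} {D : ℕ} (h : ∀ x, (f x).deg ≤ D) (l : List α) :
    (any f l).deg ≤ D :=
  max_le (deg_all_le (fun x => max_le (h x) (Nat.zero_le _)) l) (Nat.zero_le _)

theorem deg_listSum_le {α : Type*} {f : α → Expr} {D : ℕ} (h : ∀ x, (f x).deg ≤ D) (l : List α) :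
    (listSum f l).deg ≤ D := by
  induction l with
  | nil => exact Nat.zero_le _
  | cons x l ih => exact max_le (h x) ih

theorem deg_pow (j : ℕ) : (pow j).deg = 0 := by
  induction j with
  | zero => rfl
  | succ j ih => simp [pow, deg, ih]

theorem deg_digit_le {X : Expr} {D : ℕ} (h : X.deg ≤ D) (i : ℕ) : (digit i X).deg ≤ D := by
  simp [digit, deg, deg_pow, h]

end Expr

/-! ### Tuples of vertices -/

/-- The tuple of vertices with code `X`: the digits of `X` in base `n`. -/
def tuple (n : ℕ) [NeZero n] (N X : ℕ) : Fin N → Fin n := fun i => Fin.ofNat n (X / n ^ (i : ℕ))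

theorem finFunctionFinEquiv_symm_eq_tuple (n : ℕ) [NeZero n] (N : ℕ) (X : Fin (n ^ N)) :
    finFunctionFinEquiv.symm X = tuple n N X := by
  funext i
  apply Fin.ext
  rw [finFunctionFinEquiv_symm_apply_val]
  rfl

theorem exists_code (n : ℕ) [NeZero n] {N : ℕ} (x : Fin N → Fin n) :
    ∃ X < n ^ N, tuple n N X = x :=
  ⟨finFunctionFinEquiv x, Fin.is_lt _, by
    rw [← finFunctionFinEquiv_symm_eq_tuple, Equiv.symm_apply_apply]⟩

open Classical in
theorem card_codes (n : ℕ) [NeZero n] (N : ℕ) (P : (Fin N → Fin n) → Prop) :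
    #{X ∈ range (n ^ N) | P (tuple n N X)} = #{x : Fin N → Fin n | P x} := by
  refine card_bij (fun X _ => tuple n N X) (fun X hX => ?_) (fun X hX X' hX' he => ?_)
    fun x hx => ?_
  · simpa using (mem_filter.1 hX).2
  · have h1 := finFunctionFinEquiv_symm_eq_tuple n N ⟨X, mem_range.1 (mem_filter.1 hX).1⟩
    have h2 := finFunctionFinEquiv_symm_eq_tuple n N ⟨X', mem_range.1 (mem_filter.1 hX').1⟩
    exact Fin.mk.inj_iff.1 (finFunctionFinEquiv.symm.injective (h1.trans (he.trans h2.symm)))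
  · obtain ⟨X, hX, rfl⟩ := exists_code n x
    exact ⟨X, mem_filter.2 ⟨mem_range.2 hX, (mem_filter.1 hx).2⟩, rfl⟩

/-- The tuple with code `X` absorbs the tuple with code `Y`. -/
def AbsorbsCode {k n : ℕ} [NeZero n] (t : ℕ) (H : KGraph k (Fin n)) (X Y : ℕ) : Prop :=
  H.AbsorbsTuple (tuple n (t * k * k) X) (tuple n k Y)

/-- The tuples of length `s` with codes `X` and `X'` have no common vertex. -/
def DisjointCodes (n : ℕ) [NeZero n] (s X X' : ℕ) : Prop :=
  ∀ i j, tuple n s X i ≠ tuple n s X' j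

namespace Expr

/-- Test whether `v 0, …, v (k - 1)` form an edge. -/
def edge {k : ℕ} (v : Fin k → Expr) : Expr :=
  .load (.op .add (.op .add (.num 2) .size)
    (listSum (fun j : Fin k => .op .mul (v j) (pow j)) (List.finRange k)))

/-- Test whether the distinct vertices `v i` have a perfect matching. -/
noncomputable def matching (k m : ℕ) (v : Fin (m * k) → Expr) : Expr :=
  any (fun σ : Equiv.Perm (Fin (m * k)) =>
    all (fun b : Fin m => edge fun j : Fin k => v (σ (finProdFinEquiv (b, j)))) (List.finRange m))
    (univ : Finset (Equiv.Perm (Fin (m * k)))).toList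

/-- Test whether the values `v i` are distinct. -/
noncomputable def distinct {ι : Type*} [Fintype ι] [DecidableEq ι] (v : ι → Expr) : Expr :=
  all (fun q : ι × ι => not (.op .eq (v q.1) (v q.2))) (univ : Finset ι).offDiag.toList

/-- The positions in a tuple of `m + 1` blocks. -/
def blockEquiv (k m : ℕ) : Fin ((m + 1) * k) ≃ Fin (m * k) ⊕ Fin k :=
  (finCongr (Nat.succ_mul m k)).trans finSumFinEquiv.symm

/-- Test whether `X` absorbs `Y`. -/
noncomputable def absorbs (k t : ℕ) (X Y : Expr) : Expr :=
  and (distinct (Sum.elim (fun i : Fin (t * k * k) => digit i X) fun i : Fin k => digit i Y))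
    (and (matching k (t * k) fun i => digit i X)
      (matching k (t * k + 1) fun i =>
        Sum.elim (fun i : Fin (t * k * k) => digit i X) (fun i : Fin k => digit i Y)
          (blockEquiv k (t * k) i)))

/-- Test whether `X` and `X'` have no common vertex. -/
noncomputable def disjoint (s : ℕ) (X X' : Expr) : Expr :=
  all (fun q : Fin s × Fin s => not (.op .eq (digit q.1 X) (digit q.2 X')))
    (univ : Finset (Fin s × Fin s)).toList

theorem deg_edge_le {k D : ℕ} {v : Fin k → Expr} (h : ∀ j, (v j).deg ≤ D) : (edge v).deg ≤ D :=
  max_le (Nat.zero_le _) (deg_listSum_le (fun j => max_le (h j) ((deg_pow _).le.trans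
    (Nat.zero_le _))) _)

theorem deg_matching_le {k m D : ℕ} {v : Fin (m * k) → Expr} (h : ∀ j, (v j).deg ≤ D) :
    (matching k m v).deg ≤ D :=
  deg_any_le (fun _ => deg_all_le (fun _ => deg_edge_le fun _ => h _) _) _

theorem deg_absorbs_le {k t D : ℕ} {X Y : Expr} (hX : X.deg ≤ D) (hY : Y.deg ≤ D) :
    (absorbs k t X Y).deg ≤ D := by
  have h : ∀ i, (Sum.elim (fun i : Fin (t * k * k) => digit i X) (fun i : Fin k => digit i Y)
      i).deg ≤ D := by
    rintro (i | i)
    · exact deg_digit_le hX _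
    · exact deg_digit_le hY _
  exact max_le (deg_all_le (fun q => max_le (max_le (h _) (h _)) (Nat.zero_le _)) _)
    (max_le (deg_matching_le fun _ => deg_digit_le hX _) (deg_matching_le fun _ => h _))

theorem deg_disjoint_le {s D : ℕ} {X Y : Expr} (hX : X.deg ≤ D) (hY : Y.deg ≤ D) :
    (disjoint s X Y).deg ≤ D :=
  deg_all_le (fun _ => max_le (max_le (deg_digit_le hX _) (deg_digit_le hY _)) (Nat.zero_le _)) _

/-- The adjacency table of `H` is stored in the memory. -/
def HasTable {k n : ℕ} (H : KGraph k (Fin n)) (mem : ℕ → ℕ) : Prop :=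
  ∀ x : Fin k → Fin n, (univ.image x ∈ H.edges → mem (2 + n + finFunctionFinEquiv x) = 1) ∧
    (univ.image x ∉ H.edges → mem (2 + n + finFunctionFinEquiv x) = 0)

variable {k n w : ℕ} {H : KGraph k (Fin n)} {mem env : ℕ → ℕ}

/-- The adjacency table is indexed by the base-`n` number of the tuple and starts after the `2 + n`
header cells; `hw` makes all its addresses fit in a word. -/
theorem tests_edge (hw : 2 + n + n ^ k ≤ 2 ^ w) (hH : HasTable H mem) {v : Fin k → Expr}
    {x : Fin k → Fin n} (hv : ∀ j, (v j).eval w n mem env = x j) :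
    Tests w n mem env (edge v) (univ.image x ∈ H.edges) := by
  have h1 : (listSum (fun j : Fin k => .op .mul (v j) (pow j)) (List.finRange k)).eval w n mem env =
      (finFunctionFinEquiv x : ℕ) := by
    rw [eval_listSum (g := fun j : Fin k => (x j : ℕ) * n ^ (j : ℕ)), ← List.ofFn_eq_map,
      List.sum_ofFn, finFunctionFinEquiv_apply, Nat.mod_eq_of_lt]
    · rw [← finFunctionFinEquiv_apply]
      exact (Fin.is_lt _).trans_le (by omega)
    · intro j _
      simp only [eval, BinOp.eval, hv, eval_pow_mod]
      exact Nat.mul_mod_mod _ _ _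
  have hlt := (finFunctionFinEquiv x).is_lt
  have h2 : (edge v).eval w n mem env = mem (2 + n + finFunctionFinEquiv x) % 2 ^ w := by
    simp only [edge, eval, BinOp.eval, h1]
    rw [Nat.mod_eq_of_lt (show 2 < 2 ^ w by omega), Nat.mod_eq_of_lt (show n < 2 ^ w by omega),
      Nat.mod_eq_of_lt (show 2 + n < 2 ^ w by omega),
      Nat.mod_eq_of_lt (show 2 + n + (finFunctionFinEquiv x : ℕ) < 2 ^ w by omega)]
  constructor
  · intro h
    rw [h2, (hH x).1 h, Nat.mod_eq_of_lt (by omega)]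
  · intro h
    rw [h2, (hH x).2 h, Nat.zero_mod]

theorem tests_distinct (hw : 1 < 2 ^ w) {ι : Type*} [Fintype ι] [DecidableEq ι] {v : ι → Expr}
    {x : ι → Fin n} (hv : ∀ j, (v j).eval w n mem env = x j) :
    Tests w n mem env (distinct v) (Function.Injective x) := by
  refine (Tests.all (P := fun q : ι × ι => ¬ (x q.1 : ℕ) = x q.2) hw fun q _ =>
    (Tests.eq hw (hv _) (hv _)).not hw).congr ?_
  simp only [mem_toList, mem_offDiag, mem_univ, true_and, Prod.forall, Fin.val_inj]
  exact ⟨fun h a b hab => by_contra fun hne => h a b hne hab, fun h a b hne hab => hne (h hab)⟩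

/-- By `hasPerfectMatchingOn_image_iff` it suffices to try all permutations of the `m * k`
positions. This is a fixed finite disjunction, so it adds nothing to the exponent of the running
time. -/
theorem tests_matching (hk : 0 < k) (hw : 2 + n + n ^ k ≤ 2 ^ w) (hH : HasTable H mem) {m : ℕ}
    {v : Fin (m * k) → Expr} {x : Fin (m * k) → Fin n} (hx : Function.Injective x)
    (hv : ∀ j, (v j).eval w n mem env = x j) :
    Tests w n mem env (matching k m v) (H.HasPerfectMatchingOn (univ.image x)) := by
  have hw1 : 1 < 2 ^ w := by omega
  refine (Tests.any hw1 fun σ _ => Tests.all hw1 fun b _ =>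
    tests_edge (x := fun j : Fin k => x (σ (finProdFinEquiv (b, j)))) hw hH fun j => hv _).congr ?_
  rw [H.hasPerfectMatchingOn_image_iff hk x hx]
  simp

theorem tests_absorbs [NeZero n] {t : ℕ} (hk : 0 < k) (hw : 2 + n + n ^ k ≤ 2 ^ w)
    (hs : n ^ (t * k * k) < 2 ^ w) (hH : HasTable H mem) {X Y : Expr} {x y : ℕ}
    (hX : X.eval w n mem env = x) (hY : Y.eval w n mem env = y) :
    Tests w n mem env (absorbs k t X Y) (AbsorbsCode t H x y) := by
  have hw1 : 1 < 2 ^ w := by omega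
  have hn : 1 ≤ n := NeZero.one_le
  have dX : ∀ i : Fin (t * k * k), (digit i X).eval w n mem env = tuple n (t * k * k) x i :=
    fun i => eval_digit (by omega)
      ((Nat.pow_le_pow_right hn i.is_lt.le).trans_lt hs) hX
  have dY : ∀ i : Fin k, (digit i Y).eval w n mem env = tuple n k y i :=
    fun i => eval_digit (by omega)
      ((Nat.pow_le_pow_right hn i.is_lt.le).trans_lt (by omega)) hY
  have dXY : ∀ i, (Sum.elim (fun i : Fin (t * k * k) => digit i X) (fun i : Fin k => digit i Y)
      i).eval w n mem env = Sum.elim (tuple n (t * k * k) x) (tuple n k y) i := by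
    rintro (i | i)
    · exact dX i
    · exact dY i
  refine (tests_distinct hw1 dXY).and hw1 fun hinj => ?_
  refine (tests_matching hk hw hH (fun a b h => ?_) dX).and hw1 fun _ => ?_
  · simpa using @hinj (.inl a) (.inl b) h
  · refine (tests_matching hk hw hH
      (x := Sum.elim (tuple n (t * k * k) x) (tuple n k y) ∘ blockEquiv k (t * k))
      (hinj.comp (Equiv.injective _)) fun i => dXY _).congr ?_
    suffices h : univ.image (Sum.elim (tuple n (t * k * k) x) (tuple n k y) ∘
        blockEquiv k (t * k)) =
        univ.image (tuple n (t * k * k) x) ∪ univ.image (tuple n k y) by rw [h]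
    ext v
    simp only [mem_image, mem_union, mem_univ, true_and, Function.comp]
    constructor
    · rintro ⟨i, rfl⟩
      rcases blockEquiv k (t * k) i with j | j
      · exact Or.inl ⟨j, rfl⟩
      · exact Or.inr ⟨j, rfl⟩
    · rintro (⟨j, rfl⟩ | ⟨j, rfl⟩)
      · exact ⟨(blockEquiv k (t * k)).symm (.inl j), by simp⟩
      · exact ⟨(blockEquiv k (t * k)).symm (.inr j), by simp⟩

theorem tests_disjoint [NeZero n] {s : ℕ} (hw : 1 < 2 ^ w) (hn : n < 2 ^ w) (hs : n ^ s < 2 ^ w)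
    {X Y : Expr} {x y : ℕ} (hX : X.eval w n mem env = x) (hY : Y.eval w n mem env = y) :
    Tests w n mem env (disjoint s X Y) (DisjointCodes n s x y) := by
  have d : ∀ {X x}, X.eval w n mem env = x → ∀ i : Fin s,
      (digit i X).eval w n mem env = tuple n s x i := fun h i =>
    eval_digit hn ((Nat.pow_le_pow_right NeZero.one_le i.is_lt.le).trans_lt hs) h
  refine (Tests.all (P := fun q : Fin s × Fin s => ¬ (tuple n s x q.1 : ℕ) = tuple n s y q.2) hw
    fun q _ => (Tests.eq hw (d hX _) (d hY _)).not hw).congr ?_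
  simp [DisjointCodes, Fin.val_inj]

end Expr

end WordRAM

/-! ### The program -/

namespace WordRAM

namespace Expr

/-- The entry `i` of the record of chosen tuples. -/
def entry (k : ℕ) (i : Expr) : Expr := .load (.op .add (pow (k + 2)) i)

/-- The code of the chosen tuple `i`. -/
def chosen (k : ℕ) (i : Expr) : Expr := .op .sub (entry k i) (.num 1)

/-- The number of chosen tuples that absorb the value of the variable `y`. -/
noncomputable def hits (k t y : ℕ) : Expr :=
  .sum 1 (and (.op .lt (.num 0) (entry k (.var 0)))
    (absorbs k t (chosen k (.var 0)) (.var (y + 1))))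

/-- Test whether the value of the variable `y` is absorbed by many tuples. -/
noncomputable def rich (k t G y : ℕ) : Expr :=
  not (.op .lt (.op .mul (.num G) (.sum (t * k * k) (absorbs k t (.var 0) (.var (y + 1)))))
    (pow (t * k * k)))

/-- Test whether the value of the variable `y` still has to be absorbed. -/
noncomputable def wants (k t G C y : ℕ) : Expr :=
  and (.op .lt (hits k t y) (.num C)) (rich k t G y)

/-- The number of tuples that still have to be absorbed. -/
noncomputable def wanting (k t G C : ℕ) : Expr := .sum k (wants k t G C 0)

/-- The gain of the value of the variable `x`. -/
noncomputable def gain (k t G C x : ℕ) : Expr :=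
  .sum k (and (wants k t G C 0) (absorbs k t (.var (x + 1)) (.var 0)))

/-- The number of chosen tuples that meet the value of the variable `x`. -/
noncomputable def conflicts (k t x : ℕ) : Expr :=
  .sum 1 (and (.op .lt (.num 0) (entry k (.var 0)))
    (not (disjoint (t * k * k) (chosen k (.var 0)) (.var (x + 1)))))

/-- Test whether the value of the variable `x` may be chosen. -/
noncomputable def eligible (k t G C x : ℕ) : Expr :=
  and (.op .eq (conflicts k t x) (.num 0)) (and (.op .lt (.num 0) (gain k t G C x))
    (not (.op .lt (.op .mul (.num (2 * G)) (gain k t G C x)) (wanting k t G C))))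

/-- The successor of the first tuple that may be chosen, or `0`. -/
noncomputable def select (k t G C : ℕ) : Expr :=
  .op .mod (.op .add (.sum (t * k * k) (.op .eq (.sum (t * k * k)
    (and (not (.op .lt (.var 1) (.var 0))) (eligible k t G C 0))) (.num 0))) (.num 1))
    (.op .add (pow (t * k * k)) (.num 1))

/-- The address for the round in which the counter, the variable `0`, counts down from `n - 1`. -/
def roundAddress (k : ℕ) : Expr :=
  .op .add (pow (k + 2)) (.op .sub (.op .sub .size (.num 1)) (.var 0))

/-- The vertex at the position of the output given by the variable `0`. -/
def outVertex (k s : ℕ) : Expr :=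
  listSum (fun j : Fin s => .op .mul (.op .eq (.op .mod (.var 0) (.num s)) (.num j))
    (digit j (chosen k (.op .div (.var 0) (.num s))))) (List.finRange s)

/-- The number of chosen tuples. -/
def members (k : ℕ) : Expr := .sum 1 (.op .lt (.num 0) (entry k (.var 0)))

theorem deg_chosen_le {k D : ℕ} {i : Expr} (h : i.deg ≤ D) : (chosen k i).deg ≤ D := by
  simp [chosen, entry, deg, deg_pow, h]

theorem deg_wants_le {k t G C y : ℕ} (hk : 1 ≤ t * k * k) :
    (wants k t G C y).deg ≤ t * k * k := by
  have h1 : (hits k t y).deg ≤ 1 := by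
    have := deg_absorbs_le (k := k) (t := t) (D := 0) (X := chosen k (.var 0)) (Y := .var (y + 1))
      (deg_chosen_le le_rfl) le_rfl
    simp only [hits, and, deg, entry, deg_pow]
    omega
  have h2 : (rich k t G y).deg ≤ t * k * k := by
    have := deg_absorbs_le (k := k) (t := t) (D := 0) (X := .var 0) (Y := .var (y + 1)) le_rfl le_rfl
    simp only [rich, not, deg, deg_pow]
    omega
  simp only [wants, and, deg]
  omega

theorem deg_eligible_le {k t G C x : ℕ} (hk : 1 ≤ t * k * k) :
    (eligible k t G C x).deg ≤ k + t * k * k := by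
  have h1 : (conflicts k t x).deg ≤ 1 := by
    have := deg_disjoint_le (s := t * k * k) (D := 0) (X := chosen k (.var 0)) (Y := .var (x + 1))
      (deg_chosen_le le_rfl) le_rfl
    simp only [conflicts, and, not, deg, entry, deg_pow]
    omega
  have h2 := deg_wants_le (G := G) (C := C) (y := 0) hk
  have h3 := deg_absorbs_le (k := k) (t := t) (D := 0) (X := .var (x + 1)) (Y := .var 0)
    le_rfl le_rfl
  simp only [eligible, gain, wanting, and, not, deg]
  omega

/-- Searching for the first eligible candidate takes two nested sums over candidates. The
eligibility test inside sums over `k`-tuples, and within that the richness test sums over candidates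
once more. -/
theorem deg_select_le {k t G C : ℕ} (hk : 1 ≤ t * k * k) :
    (select k t G C).deg ≤ 3 * (t * k * k) + k := by
  have := deg_eligible_le (G := G) (C := C) (x := 0) hk
  simp only [select, and, not, deg, deg_pow]
  omega

theorem deg_outVertex_le (k s : ℕ) : (outVertex k s).deg ≤ 0 :=
  deg_listSum_le (fun _ => max_le le_rfl (deg_digit_le (deg_chosen_le le_rfl) _)) _

theorem deg_members (k : ℕ) : (members k).deg = 1 := by
  simp [members, entry, deg, deg_pow]

/-- `G` and `C` occur only as constants, each costing one step, so the factor in the running time is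
independent of `C'`, `β` and `μ`. -/
theorem cost_select (k t G C : ℕ) : (select k t G C).cost = (select k t 0 0).cost := by
  simp only [select, eligible, conflicts, gain, wanting, wants, rich, hits, and, not, cost]

/-! ### Correctness of the expressions, without overflow. -/

/-- The size of the input is large in terms of the parameters, and so is the word length. -/
structure Adequate (k t G C n w : ℕ) : Prop where
  two_le : 2 ≤ n
  gain_le : 2 * G ≤ n
  le_size : C ≤ n
  length_le : t * k * k ≤ n
  word : n ^ (t * k * k + k + 3) < 2 ^ w

section

variable {k t G C n w : ℕ}

theorem Adequate.pow_lt (h : Adequate k t G C n w) {j : ℕ} (hj : j ≤ t * k * k + k + 3) :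
    n ^ j < 2 ^ w :=
  (Nat.pow_le_pow_right (by have := h.two_le; omega) hj).trans_lt h.word

theorem Adequate.size_lt (h : Adequate k t G C n w) : n < 2 ^ w := by
  simpa using h.pow_lt (j := 1) (by omega)

theorem Adequate.one_lt (h : Adequate k t G C n w) : 1 < 2 ^ w := by
  have := h.two_le
  have := h.size_lt
  omega

/-- The input ends before cell `n ^ (k + 2)`, where the record begins, so recording choices never
damages the table. -/
theorem Adequate.table_le (h : Adequate k t G C n w) (hk : 2 ≤ k) :
    2 + n + n ^ k ≤ n ^ (k + 2) := by
  have h2 := h.two_le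
  have h1 : n ^ 1 ≤ n ^ k := Nat.pow_le_pow_right (by omega) (by omega)
  have h3 : 2 * 2 ≤ n * n := Nat.mul_le_mul h2 h2
  have h4 := Nat.mul_le_mul_left (n ^ k) h3
  rw [pow_add, pow_two]
  rw [pow_one] at h1
  omega

theorem Adequate.record_lt (h : Adequate k t G C n w) (hk : 2 ≤ k) {i : ℕ} (hi : i < n) :
    n ^ (k + 2) + i < 2 ^ w := by
  have h2 := h.two_le
  have h1 : n ^ 1 ≤ n ^ (k + 2) := Nat.pow_le_pow_right (by omega) (by omega)
  have h4 := Nat.mul_le_mul_left (n ^ (k + 2)) h2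
  have h5 := h.pow_lt (j := k + 3) (by omega)
  rw [pow_succ n (k + 2)] at h5
  rw [pow_one] at h1
  omega

/-- The memory holds the adjacency table of `H` and the record `c`. -/
structure Holds {n : ℕ} (H : KGraph k (Fin n)) (w : ℕ) (mem c : ℕ → ℕ) : Prop where
  table : HasTable H mem
  record : ∀ i < n, mem (n ^ (k + 2) + i) = c i
  record_lt : ∀ i < n, c i < 2 ^ w

variable {H : KGraph k (Fin n)} {mem c env : ℕ → ℕ}

theorem eval_var {v x : ℕ} (h : env v = x) (hx : x < 2 ^ w) :
    (Expr.var v).eval w n mem env = x := by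
  simp only [eval, h, Nat.mod_eq_of_lt hx]

theorem eval_num {m : ℕ} (hx : m < 2 ^ w) : (Expr.num m).eval w n mem env = m :=
  Nat.mod_eq_of_lt hx

theorem eval_entry (h : Adequate k t G C n w) (hk : 2 ≤ k) (hm : Holds H w mem c) {e : Expr} {i : ℕ}
    (he : e.eval w n mem env = i) (hi : i < n) : (entry k e).eval w n mem env = c i := by
  simp only [entry, eval, BinOp.eval, eval_pow (h.pow_lt (j := k + 2) (by omega)), he]
  rw [Nat.mod_eq_of_lt (h.record_lt hk hi), hm.record i hi, Nat.mod_eq_of_lt (hm.record_lt i hi)]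

theorem eval_chosen (h : Adequate k t G C n w) (hk : 2 ≤ k) (hm : Holds H w mem c) {e : Expr}
    {i : ℕ} (he : e.eval w n mem env = i) (hi : i < n) :
    (chosen k e).eval w n mem env = c i - 1 := by
  simp only [chosen, eval, BinOp.eval, eval_entry h hk hm he hi, Nat.mod_eq_of_lt h.one_lt]
  exact Nat.mod_eq_of_lt ((Nat.sub_le _ _).trans_lt (hm.record_lt i hi))

variable [NeZero n]

theorem tests_absorbs_of_holds (h : Adequate k t G C n w) (hk : 2 ≤ k) (hm : Holds H w mem c) {X Y : Expr}
    {x y : ℕ} (hX : X.eval w n mem env = x) (hY : Y.eval w n mem env = y) :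
    Tests w n mem env (absorbs k t X Y) (AbsorbsCode t H x y) :=
  tests_absorbs (by omega)
    ((h.table_le hk).trans (h.pow_lt (by omega)).le) (h.pow_lt (by omega)) hm.table hX hY

theorem eval_hits (h : Adequate k t G C n w) (hk : 2 ≤ k) (hm : Holds H w mem c) {y Y : ℕ}
    (hy : env y = Y) (hY : Y < 2 ^ w) :
    (hits k t y).eval w n mem env = Greedy.hits n (AbsorbsCode t H) c Y := by
  rw [hits, eval_sum_tests (P := fun i => 0 < c i ∧ AbsorbsCode t H (c i - 1) Y)
    (h.pow_lt (by omega)) fun i hi => ?_]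
  · rw [pow_one]; rfl
  · rw [pow_one] at hi
    have hv : (Expr.var 0).eval w n mem (push i env) = i := eval_var rfl (hi.trans h.size_lt)
    exact (Tests.lt h.one_lt (eval_num (by positivity)) (eval_entry h hk hm hv hi)).and h.one_lt
      fun _ => tests_absorbs_of_holds h hk hm (eval_chosen h hk hm hv hi) (eval_var (by simpa using hy) hY)

theorem tests_rich (h : Adequate k t G C n w) (hk : 2 ≤ k) (hm : Holds H w mem c) {y Y : ℕ}
    (hy : env y = Y) (hY : Y < 2 ^ w) :
    Tests w n mem env (rich k t G y) (Greedy.Rich (n ^ (t * k * k)) G (AbsorbsCode t H) Y) := by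
  classical
  have h1 : (Expr.sum (t * k * k) (absorbs k t (.var 0) (.var (y + 1)))).eval w n mem env =
      #{X ∈ range (n ^ (t * k * k)) | AbsorbsCode t H X Y} :=
    eval_sum_tests (h.pow_lt (by omega)) fun X hX =>
      tests_absorbs_of_holds h hk hm (eval_var rfl (hX.trans (h.pow_lt (by omega))))
        (eval_var (by simpa using hy) hY)
  have hG : G ≤ n := by have := h.gain_le; omega
  refine ((Tests.lt (x := G * #{X ∈ range (n ^ (t * k * k)) | AbsorbsCode t H X Y})
    h.one_lt ?_ (eval_pow (h.pow_lt (by omega)))).not h.one_lt).congr ?_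
  · simp only [eval, BinOp.eval] at h1 ⊢
    rw [h1, Nat.mod_eq_of_lt (hG.trans_lt h.size_lt), Nat.mod_eq_of_lt]
    calc _ ≤ n * n ^ (t * k * k) := Nat.mul_le_mul hG
          ((card_le_card (filter_subset _ _)).trans (card_range _).le)
      _ = n ^ (t * k * k + 1) := (pow_succ' _ _).symm
      _ < 2 ^ w := h.pow_lt (by omega)
  · rw [not_lt]
    unfold Greedy.Rich
    convert Iff.rfl

theorem tests_wants (h : Adequate k t G C n w) (hk : 2 ≤ k) (hm : Holds H w mem c) {y Y : ℕ}
    (hy : env y = Y) (hY : Y < 2 ^ w) :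
    Tests w n mem env (wants k t G C y)
      (Greedy.Wanting n (n ^ (t * k * k)) G C (AbsorbsCode t H) c Y) :=
  (Tests.lt h.one_lt (eval_hits h hk hm hy hY)
    (eval_num (h.le_size.trans_lt h.size_lt))).and h.one_lt fun _ => tests_rich h hk hm hy hY

theorem eval_wanting (h : Adequate k t G C n w) (hk : 2 ≤ k) (hm : Holds H w mem c) :
    (wanting k t G C).eval w n mem env =
      Greedy.wanting n (n ^ (t * k * k)) (n ^ k) G C (AbsorbsCode t H) c := by
  have hp : n ^ k < 2 ^ w := h.pow_lt (by omega)
  exact eval_sum_tests hp fun Y hY => tests_wants (env := push Y env) h hk hm rfl (hY.trans hp)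

theorem eval_gain (h : Adequate k t G C n w) (hk : 2 ≤ k) (hm : Holds H w mem c) {x X : ℕ}
    (hx : env x = X) (hX : X < 2 ^ w) :
    (gain k t G C x).eval w n mem env =
      Greedy.gain n (n ^ (t * k * k)) (n ^ k) G C (AbsorbsCode t H) c X := by
  have hp : n ^ k < 2 ^ w := h.pow_lt (by omega)
  exact eval_sum_tests hp fun Y hY => (tests_wants (y := 0) (env := push Y env) h hk hm rfl
    (hY.trans hp)).and h.one_lt fun _ => tests_absorbs_of_holds h hk hm (eval_var (by simpa using hx) hX)
      (eval_var rfl (hY.trans hp))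

open Classical in
theorem eval_conflicts (h : Adequate k t G C n w) (hk : 2 ≤ k) (hm : Holds H w mem c) {x X : ℕ}
    (hx : env x = X) (hX : X < 2 ^ w) :
    (conflicts k t x).eval w n mem env =
      #{i ∈ range n | 0 < c i ∧ ¬ DisjointCodes n (t * k * k) (c i - 1) X} := by
  rw [conflicts, eval_sum_tests (P := fun i => 0 < c i ∧ ¬ DisjointCodes n (t * k * k) (c i - 1) X)
    (h.pow_lt (by omega)) fun i hi => ?_]
  · rw [pow_one]
  · rw [pow_one] at hi
    have hv : (Expr.var 0).eval w n mem (push i env) = i := eval_var rfl (hi.trans h.size_lt)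
    exact (Tests.lt h.one_lt (eval_num (by positivity)) (eval_entry h hk hm hv hi)).and h.one_lt
      fun _ => (tests_disjoint h.one_lt h.size_lt (h.pow_lt (by omega))
        (eval_chosen h hk hm hv hi) (eval_var (by simpa using hx) hX)).not h.one_lt

theorem tests_eligible (h : Adequate k t G C n w) (hk : 2 ≤ k) (hm : Holds H w mem c) {x X : ℕ}
    (hx : env x = X) (hX : X < 2 ^ w) :
    Tests w n mem env (eligible k t G C x)
      (Greedy.Eligible n (n ^ (t * k * k)) (n ^ k) G C (AbsorbsCode t H)
        (DisjointCodes n (t * k * k)) c X) := by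
  classical
  have hg := eval_gain h hk hm hx hX
  have h0 : (Expr.num 0).eval w n mem env = 0 := eval_num (by positivity)
  have hgl : Greedy.gain n (n ^ (t * k * k)) (n ^ k) G C (AbsorbsCode t H) c X ≤ n ^ k :=
    (card_le_card (filter_subset _ _)).trans (card_range _).le
  refine ((Tests.eq h.one_lt (eval_conflicts h hk hm hx hX) h0).and h.one_lt fun _ =>
    (Tests.lt h.one_lt h0 hg).and h.one_lt fun _ => (Tests.lt
      (x := 2 * G * Greedy.gain n (n ^ (t * k * k)) (n ^ k) G C (AbsorbsCode t H) c X)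
      h.one_lt ?_ (eval_wanting h hk hm)).not h.one_lt).congr ?_
  · simp only [eval, BinOp.eval] at hg ⊢
    rw [hg, Nat.mod_eq_of_lt (h.gain_le.trans_lt h.size_lt), Nat.mod_eq_of_lt]
    calc _ ≤ n * n ^ k := Nat.mul_le_mul h.gain_le hgl
      _ = n ^ (k + 1) := (pow_succ' _ _).symm
      _ < 2 ^ w := h.pow_lt (by omega)
  · unfold Greedy.Eligible
    convert Iff.rfl

open Classical in
theorem eval_select (h : Adequate k t G C n w) (hk : 2 ≤ k) (hm : Holds H w mem c) :
    (select k t G C).eval w n mem env =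
      Greedy.select n (n ^ (t * k * k)) (n ^ k) G C (AbsorbsCode t H)
        (DisjointCodes n (t * k * k)) c := by
  have hp : n ^ (t * k * k) < 2 ^ w := h.pow_lt (by omega)
  -- The modulus must itself fit in a word, since otherwise the final reduction would not return `0`
  -- in the case of no candidate.
  have hp1 : n ^ (t * k * k) + 1 < 2 ^ w := by
    have h1 := h.pow_lt (j := t * k * k + 1) (by omega)
    have h2 := h.two_le
    have h3 := Nat.mul_le_mul_left (n ^ (t * k * k)) h2
    have h4 : 1 ≤ n ^ (t * k * k) := Nat.one_le_pow _ _ (by omega)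
    rw [pow_succ] at h1
    omega
  set P : ℕ → Prop := fun X => #{X' ∈ range (n ^ (t * k * k)) | ¬ X < X' ∧
    Greedy.Eligible n (n ^ (t * k * k)) (n ^ k) G C (AbsorbsCode t H)
      (DisjointCodes n (t * k * k)) c X'} = 0 with hP
  have h1 : (Expr.sum (t * k * k) (.op .eq (.sum (t * k * k)
      (and (not (.op .lt (.var 1) (.var 0))) (eligible k t G C 0))) (.num 0))).eval w n mem env =
      #{X ∈ range (n ^ (t * k * k)) | P X} := by
    refine eval_sum_tests hp fun X hX => Tests.eq h.one_lt ?_ (eval_num (by positivity))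
    refine eval_sum_tests hp fun X' hX' => ?_
    exact ((Tests.lt h.one_lt (eval_var (v := 1) (env := push X' (push X env)) rfl (hX.trans hp))
      (eval_var (v := 0) rfl (hX'.trans hp))).not h.one_lt).and h.one_lt
        fun _ => tests_eligible h hk hm rfl (hX'.trans hp)
  have hle : #{X ∈ range (n ^ (t * k * k)) | P X} ≤ n ^ (t * k * k) :=
    (card_le_card (filter_subset _ _)).trans (card_range _).le
  have h3 : ∀ a b : Expr, (Expr.op .mod (.op .add a (.num 1)) (.op .add b (.num 1))).eval w n mem
      env = ((a.eval w n mem env + 1) % 2 ^ w) % ((b.eval w n mem env + 1) % 2 ^ w) % 2 ^ w :=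
    fun a b => by simp only [eval, BinOp.eval, Nat.mod_eq_of_lt h.one_lt]
  have h4 : Greedy.select n (n ^ (t * k * k)) (n ^ k) G C (AbsorbsCode t H)
      (DisjointCodes n (t * k * k)) c =
      (#{X ∈ range (n ^ (t * k * k)) | P X} + 1) % (n ^ (t * k * k) + 1) := by
    unfold Greedy.select
    congr!
  rw [select, h3, h1, h4, eval_pow hp]
  generalize #{X ∈ range (n ^ (t * k * k)) | P X} = g at hle ⊢
  rw [Nat.mod_eq_of_lt hp1, Nat.mod_eq_of_lt (show g + 1 < 2 ^ w by omega)]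
  exact Nat.mod_eq_of_lt ((Nat.mod_lt _ (Nat.succ_pos _)).trans hp1)

end

end Expr

end WordRAM

/-! ### Memory layout, output and running time. -/

namespace WordRAM

open _root_.WordRAM.Expr

section

variable {k t G C n w : ℕ} [NeZero n] {H : KGraph k (Fin n)} {mem c : ℕ → ℕ}

/-- The counter falls while the round number `n - (L + 1)` rises. Each write goes to the record cell
of its round, mirroring the update in `Greedy.run`, and leaves the table intact. -/
theorem holds_sweep_rounds (h : Adequate k t G C n w) (hk : 2 ≤ k) {L : ℕ} (hL : L ≤ n)
    (hm : Holds H w mem (Greedy.run n (n ^ (t * k * k)) (n ^ k) G C (AbsorbsCode t H)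
      (DisjointCodes n (t * k * k)) (n - L))) :
    Holds H w (sweep w n (roundAddress k) (select k t G C) L mem)
      (Greedy.run n (n ^ (t * k * k)) (n ^ k) G C (AbsorbsCode t H)
        (DisjointCodes n (t * k * k)) n) := by
  induction L generalizing mem with
  | zero => exact hm
  | succ L ih =>
    refine ih (by omega) ?_
    have hr : n - L = (n - (L + 1)) + 1 := by omega
    have ha : (roundAddress k).eval w n mem (push L fun _ => n) =
        n ^ (k + 2) + (n - (L + 1)) := by
      have h1 : (Expr.op .sub (.op .sub .size (.num 1)) (.var 0)).eval w n mem
          (push L fun _ => n) = n - (L + 1) := by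
        simp only [eval, BinOp.eval, push_zero]
        have := h.size_lt
        rw [Nat.mod_eq_of_lt h.size_lt, Nat.mod_eq_of_lt h.one_lt,
          Nat.mod_eq_of_lt (show n - 1 < 2 ^ w by omega), Nat.mod_eq_of_lt (show L < 2 ^ w by omega),
          Nat.mod_eq_of_lt (by omega)]
        omega
      simp only [roundAddress, eval, BinOp.eval, eval_pow (h.pow_lt (j := k + 2) (by omega))] at h1 ⊢
      rw [h1]
      exact Nat.mod_eq_of_lt (h.record_lt hk (by omega))
    have hs := eval_select (env := push L fun _ => n) h hk hm
    have hlt : (select k t G C).eval w n mem (push L fun _ => n) < 2 ^ w := eval_lt ..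
    rw [ha, hr]
    simp only [Greedy.run]
    rw [← hs]
    refine ⟨fun x => ?_, fun i hi => ?_, fun i hi => ?_⟩
    · have h1 := (finFunctionFinEquiv x).is_lt
      have h2 := h.table_le hk
      rw [Function.update_of_ne (by omega)]
      exact hm.table x
    · by_cases hir : i = n - (L + 1)
      · rw [hir, Function.update_self, Function.update_self]
      · rw [Function.update_of_ne hir, Function.update_of_ne (by omega)]
        exact hm.record i hi
    · by_cases hir : i = n - (L + 1)
      · rw [hir, Function.update_self]
        exact hlt
      · rw [Function.update_of_ne hir]
        exact hm.record_lt i hi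

/-- The position of a digit is fixed in an expression, so a position known only at run time is
picked by summing all digits, each multiplied by an equality test. Only the record is assumed, since
the output may already have overwritten the table. -/
theorem eval_outVertex (h : Adequate k t G C n w) (hk : 2 ≤ k)
    (hrec : ∀ i < n, mem (n ^ (k + 2) + i) = c i) (hlt : ∀ i < n, c i < 2 ^ w) {i : ℕ}
    (hi : i < n) (j : Fin (t * k * k)) (env : ℕ → ℕ) :
    (outVertex k (t * k * k)).eval w n mem (push (i * (t * k * k) + j) env) =
      tuple n (t * k * k) (c i - 1) j := by
  have hs0 : 0 < t * k * k := j.pos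
  have hq : i * (t * k * k) + j < 2 ^ w := by
    calc i * (t * k * k) + j < i * (t * k * k) + t * k * k := by have := j.is_lt; omega
      _ = (i + 1) * (t * k * k) := by ring
      _ ≤ n * n := Nat.mul_le_mul (by omega) h.length_le
      _ = n ^ 2 := (pow_two n).symm
      _ ≤ 2 ^ w := (h.pow_lt (by omega)).le
  have hs : t * k * k < 2 ^ w := h.length_le.trans_lt h.size_lt
  have hv : (Expr.var 0).eval w n mem (push (i * (t * k * k) + j) env) = i * (t * k * k) + j :=
    eval_var rfl hq
  have hn : (Expr.num (t * k * k)).eval w n mem (push (i * (t * k * k) + j) env) = t * k * k :=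
    eval_num hs
  have hdiv : (Expr.op .div (.var 0) (.num (t * k * k))).eval w n mem
      (push (i * (t * k * k) + j) env) = i := by
    rw [eval, BinOp.eval, hv, hn, mul_comm, Nat.mul_add_div hs0, Nat.div_eq_of_lt j.is_lt, add_zero]
    exact Nat.mod_eq_of_lt (hi.trans h.size_lt)
  have hmod : (Expr.op .mod (.var 0) (.num (t * k * k))).eval w n mem
      (push (i * (t * k * k) + j) env) = j := by
    rw [eval, BinOp.eval, hv, hn, mul_comm, Nat.mul_add_mod, Nat.mod_eq_of_lt j.is_lt]
    exact Nat.mod_eq_of_lt (j.is_lt.trans hs)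
  have hch : (chosen k (.op .div (.var 0) (.num (t * k * k)))).eval w n mem
      (push (i * (t * k * k) + j) env) = c i - 1 := by
    simp only [chosen, entry, eval, BinOp.eval, eval_pow (h.pow_lt (j := k + 2) (by omega))]
      at hdiv ⊢
    rw [hdiv, Nat.mod_eq_of_lt (h.record_lt hk hi), hrec i hi, Nat.mod_eq_of_lt (hlt i hi),
      Nat.mod_eq_of_lt h.one_lt]
    exact Nat.mod_eq_of_lt ((Nat.sub_le _ _).trans_lt (hlt i hi))
  have hterm : ∀ l ∈ List.finRange (t * k * k),
      (Expr.op .mul (.op .eq (.op .mod (.var 0) (.num (t * k * k))) (.num l))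
        (digit l (chosen k (.op .div (.var 0) (.num (t * k * k)))))).eval w n mem
        (push (i * (t * k * k) + j) env) =
      (if l = j then (tuple n (t * k * k) (c i - 1) j : ℕ) else 0) % 2 ^ w := by
    intro l _
    have hd := eval_digit (i := l) h.size_lt ((Nat.pow_le_pow_right (NeZero.one_le) l.is_lt.le).trans_lt
      (h.pow_lt (j := t * k * k) (by omega))) hch
    have he := Tests.eq h.one_lt hmod (eval_num (m := l) (l.is_lt.trans hs))
    rw [eval, BinOp.eval, hd]
    split_ifs with hlj
    · rw [he.1 (by rw [hlj]), one_mul, hlj]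
      rfl
    · rw [he.2 fun h => hlj (Fin.ext h.symm), zero_mul]
  rw [outVertex, eval_listSum hterm, ← List.ofFn_eq_map, List.sum_ofFn, Finset.sum_ite_eq']
  simp only [mem_univ, if_true]
  exact Nat.mod_eq_of_lt ((Fin.is_lt _).trans h.size_lt)

/-- The sweep writes at cells `L, …, 1` in descending order, so no cell is written twice. All of
them lie below the record, because `n ^ 2 < n ^ (k + 2)`, which therefore stays readable throughout.
-/
theorem sweep_output (h : Adequate k t G C n w) (hk : 2 ≤ k) {L : ℕ} (hL : L ≤ n ^ 2)
    (hrec : ∀ i < n, mem (n ^ (k + 2) + i) = c i) (hlt : ∀ i < n, c i < 2 ^ w) :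
    (∀ a, L < a → sweep w n (.op .add (.num 1) (.var 0)) (outVertex k (t * k * k)) L mem a =
      mem a) ∧
    ∀ i < n, ∀ j : Fin (t * k * k), i * (t * k * k) + j < L →
      sweep w n (.op .add (.num 1) (.var 0)) (outVertex k (t * k * k)) L mem
        (1 + i * (t * k * k) + j) = tuple n (t * k * k) (c i - 1) j := by
  induction L generalizing mem with
  | zero => exact ⟨fun _ _ => rfl, fun _ _ _ h => absurd h (Nat.not_lt_zero _)⟩
  | succ L ih =>
    have h4 : n ^ 2 < n ^ (k + 2) :=
      Nat.pow_lt_pow_right (by have := h.two_le; omega) (by omega)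
    have h5 : n ^ (k + 2) < 2 ^ w := h.pow_lt (by omega)
    have ha : (Expr.op .add (.num 1) (.var 0)).eval w n mem (push L fun _ => n) = 1 + L := by
      simp only [eval, BinOp.eval, push_zero]
      rw [Nat.mod_eq_of_lt h.one_lt, Nat.mod_eq_of_lt (show L < 2 ^ w by omega),
        Nat.mod_eq_of_lt (by omega)]
    simp only [sweep, ha]
    obtain ⟨h1, h2⟩ := ih (mem := Function.update mem (1 + L)
      ((outVertex k (t * k * k)).eval w n mem (push L fun _ => n))) (by omega) fun i hi => by
        rw [Function.update_of_ne (by omega), hrec i hi]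
    refine ⟨fun a ha => ?_, fun i hi j hij => ?_⟩
    · rw [h1 a (by omega), Function.update_of_ne (by omega)]
    · rcases Nat.lt_succ_iff_lt_or_eq.1 hij with hlt' | heq
      · exact h2 i hi j hlt'
      · rw [show 1 + i * (t * k * k) + j = 1 + L by omega, h1 _ (by omega), Function.update_self,
          ← heq]
        exact eval_outVertex h hk hrec hlt hi j _

end

theorem encode_table {k n d : ℕ} (H : KGraph k (Fin n)) (p : Fin n → Fin d) :
    HasTable H (initState (encode H p)).mem := by
  have h : ∀ q : Fin (n ^ k), (initState (encode H p)).mem (2 + n + q) =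
      if univ.image (finFunctionFinEquiv.symm q) ∈ H.edges then 1 else 0 := by
    intro q
    have hq := q.is_lt
    have hl : ([n, d] ++ List.ofFn fun v : Fin n => (p v : ℕ)).length = 2 + n := by
      simp only [List.length_append, List.length_cons, List.length_nil, List.length_ofFn]
    simp only [initState, encode]
    rw [List.getD_append_right _ _ _ _ (by omega), List.getD_eq_getElem _ _ (by
      rw [List.length_ofFn]; omega)]
    simp only [List.getElem_ofFn]
    have : ∀ h, (⟨2 + n + (q : ℕ) - ([n, d] ++
        List.ofFn fun v : Fin n => (p v : ℕ)).length, h⟩ : Fin (n ^ k)) = q := by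
      intro h
      apply Fin.ext
      simp only [hl]
      omega
    rw [this]
  intro x
  have hx := h (finFunctionFinEquiv x)
  rw [Equiv.symm_apply_apply] at hx
  exact ⟨fun h => by rw [hx, if_pos h], fun h => by rw [hx, if_neg h]⟩

theorem encode_zero {k n d : ℕ} (H : KGraph k (Fin n)) (p : Fin n → Fin d) :
    (initState (encode H p)).mem 0 = n := rfl

theorem encode_of_le {k n d : ℕ} (H : KGraph k (Fin n)) (p : Fin n → Fin d) {a : ℕ}
    (ha : 2 + n + n ^ k ≤ a) : (initState (encode H p)).mem a = 0 := by
  simp only [initState, encode]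
  exact List.getD_eq_default _ _ (by simp; omega)

/-- Read the size of the input, choose the tuples, and write them to the output. -/
noncomputable def absorbingProgram (k t G C : ℕ) : Cmd :=
  .seq (.const 0 0) (.seq (.load 0 0) (.seq (storeLoop 1 (roundAddress k) (select k t G C))
    (.seq (storeLoop 2 (.op .add (.num 1) (.var 0)) (outVertex k (t * k * k)))
      (storeLoop 0 (.num 0) (members k)))))

/-- The implied constant of the running time of the program. -/
noncomputable def runningConstant (k t : ℕ) : ℕ :=
  ((roundAddress k).cost + (select k t 0 0).cost + 7) +
    ((Expr.op .add (.num 1) (.var 0)).cost + (outVertex k (t * k * k)).cost + 8) +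
    ((Expr.num 0).cost + (members k).cost + 6) + 2

open Classical in
theorem exec_absorbingProgram {k t G C n w d : ℕ} [NeZero n] (h : Adequate k t G C n w)
    (hk : 2 ≤ k) (ht : 1 ≤ t) (H : KGraph k (Fin n)) (p : Fin n → Fin d) {c : ℕ → ℕ}
    (hc : Greedy.run n (n ^ (t * k * k)) (n ^ k) G C (AbsorbsCode t H)
      (DisjointCodes n (t * k * k)) n = c) :
    ∃ s T, Exec w (absorbingProgram k t G C) (initState (encode H p)) s T ∧
      T ≤ runningConstant k t * n ^ (4 * (t * k * k)) ∧ s.mem 0 = #{i ∈ range n | 0 < c i} ∧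
      ∀ i < n, ∀ j : Fin (t * k * k),
        s.mem (1 + i * (t * k * k) + j) = tuple n (t * k * k) (c i - 1) j := by
  have hn : 1 ≤ n := NeZero.one_le
  -- This brings the exponent `1 + (3 s + k)` of the rounds, with `s = t k k`, below `4 s`.
  have hks : 2 * k ≤ t * k * k := by
    calc 2 * k ≤ k * k := Nat.mul_le_mul_right _ hk
      _ = 1 * k * k := by ring
      _ ≤ t * k * k := by gcongr
  set s₀ := initState (encode H p) with hs₀
  set s₁ := (s₀.setReg w 0 0).setReg w 0 ((s₀.setReg w 0 0).mem ((s₀.setReg w 0 0).reg 0)) with hs₁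
  have m₁ : s₁.mem = s₀.mem := rfl
  have r₁ : s₁.reg 0 = n := by
    rw [hs₁, State.setReg_self, State.setReg_self, State.setReg_mem, Nat.zero_mod, hs₀, encode_zero,
      Nat.mod_eq_of_lt h.size_lt]
  obtain ⟨s₂, T₂, e₂, t₂, r₂, m₂⟩ := exec_storeLoop w n hn 1 (roundAddress k) (select k t G C) s₁ r₁
  obtain ⟨s₃, T₃, e₃, t₃, r₃, m₃⟩ := exec_storeLoop w n hn 2 (.op .add (.num 1) (.var 0))
    (outVertex k (t * k * k)) s₂ r₂
  obtain ⟨s₄, T₄, e₄, t₄, r₄, m₄⟩ := exec_storeLoop w n hn 0 (.num 0) (members k) s₃ r₃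
  have hold₂ : Holds H w s₂.mem c := by
    rw [m₂, pow_one, Nat.mod_eq_of_lt h.size_lt, ← hc]
    refine holds_sweep_rounds h hk le_rfl ?_
    rw [Nat.sub_self, m₁]
    refine ⟨encode_table H p, fun i _ => ?_, fun i _ => by simp [Greedy.run]⟩
    have := h.table_le hk
    exact encode_of_le H p (by omega)
  rw [Nat.mod_eq_of_lt (h.pow_lt (by omega))] at m₃
  obtain ⟨k₃, o₃⟩ := sweep_output (L := n ^ 2) h hk le_rfl hold₂.record hold₂.record_lt
  rw [← m₃] at k₃ o₃
  have h4 : n ^ 2 < n ^ (k + 2) := Nat.pow_lt_pow_right (by have := h.two_le; omega) (by omega)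
  have rec₃ : ∀ i < n, s₃.mem (n ^ (k + 2) + i) = c i := fun i hi => by
    rw [k₃ _ (by omega), hold₂.record i hi]
  have v₄ : (members k).eval w n s₃.mem (push 0 fun _ => n) = #{i ∈ range n | 0 < c i} := by
    rw [members, eval_sum_tests (P := fun i => 0 < c i) (h.pow_lt (by omega)) fun i hi => ?_]
    · rw [pow_one]
    · rw [pow_one] at hi
      refine Tests.lt h.one_lt (eval_num (by positivity)) ?_
      have hv : (Expr.var 0).eval w n s₃.mem (push i (push 0 fun _ => n)) = i :=
        eval_var rfl (hi.trans h.size_lt)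
      simp only [entry, eval, BinOp.eval, eval_pow (h.pow_lt (j := k + 2) (by omega))] at hv ⊢
      rw [hv, Nat.mod_eq_of_lt (h.record_lt hk hi), rec₃ i hi,
        Nat.mod_eq_of_lt (hold₂.record_lt i hi)]
  have m₄' : s₄.mem = Function.update s₃.mem 0 #{i ∈ range n | 0 < c i} := by
    rw [m₄, pow_zero, Nat.mod_eq_of_lt h.one_lt]
    simp only [sweep, v₄]
    rw [eval_num (by positivity)]
  refine ⟨s₄, _, .seq (.const s₀ 0 0) (.seq (.load _ 0 0) (.seq e₂ (.seq e₃ e₄))), ?_, ?_, ?_⟩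
  · have b : ∀ {A D T}, T ≤ A * n ^ D → D ≤ 4 * (t * k * k) → T ≤ A * n ^ (4 * (t * k * k)) :=
      fun hT hD => hT.trans (Nat.mul_le_mul_left _ (Nat.pow_le_pow_right hn hD))
    have d₂ := deg_select_le (G := G) (C := C) (show 1 ≤ t * k * k by omega)
    have d₃ := deg_outVertex_le k (t * k * k)
    have t₂' := b t₂ (by simp only [roundAddress, deg, deg_pow]; omega)
    have t₃' := b t₃ (by simp only [deg]; omega)
    have t₄' := b t₄ (by simp only [deg, deg_members]; omega)
    have h1 : 1 ≤ n ^ (4 * (t * k * k)) := Nat.one_le_pow _ _ hn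
    rw [cost_select] at t₂'
    simp only [runningConstant, add_mul] at t₂' t₃' t₄' ⊢
    omega
  · rw [m₄', Function.update_self]
  · intro i hi j
    rw [m₄', Function.update_of_ne (by omega)]
    refine o₃ i hi j ?_
    calc i * (t * k * k) + j < i * (t * k * k) + t * k * k := by have := j.is_lt; omega
      _ = (i + 1) * (t * k * k) := by ring
      _ ≤ n * n := Nat.mul_le_mul (by omega) h.length_le
      _ = n ^ 2 := (pow_two n).symm

end WordRAM

/-! ### Asymptotic estimates. -/

open Classical in
theorem card_not_disjointCodes_le (n : ℕ) [NeZero n] {s : ℕ} (hs : 0 < s) (X : ℕ) :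
    #{X' ∈ range (n ^ s) | ¬ WordRAM.DisjointCodes n s X X'} * n ≤ s * s * n ^ s := by
  have h1 : #{X' ∈ range (n ^ s) | ¬ WordRAM.DisjointCodes n s X X'} ≤ s * s * n ^ (s - 1) := by
    have h := KGraph.card_meet_le (ι := Fin s) (WordRAM.tuple n s X)
    rw [Fintype.card_fin, Fintype.card_fin] at h
    have e : #{X' ∈ range (n ^ s) | ∃ i j, WordRAM.tuple n s X' i = WordRAM.tuple n s X j} =
        #{x : Fin s → Fin n | ∃ i j, x i = WordRAM.tuple n s X j} := by
      convert WordRAM.card_codes n s fun x => ∃ i j, x i = WordRAM.tuple n s X j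
    refine (card_le_card fun X' hX' => ?_).trans (e.le.trans (le_of_eq_of_le (by congr!) h))
    obtain ⟨h1, h2⟩ := mem_filter.1 hX'
    unfold WordRAM.DisjointCodes at h2
    push Not at h2
    obtain ⟨i, j, hij⟩ := h2
    exact mem_filter.2 ⟨h1, j, i, hij.symm⟩
  calc _ ≤ s * s * n ^ (s - 1) * n := Nat.mul_le_mul_right _ h1
    _ = s * s * n ^ s := by rw [mul_assoc, ← pow_succ, Nat.sub_add_cancel hs]

/-- The number of rounds is logarithmic. -/
theorem rounds_le {G C k n m : ℕ} {c : ℝ} (hG : 0 < G) (hC : 0 < C) (hn : 1 ≤ n)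
    (hc : 2 * G * C * k + 1 ≤ c) (hlog : 1 + 2 * G * C * Real.log C ≤ Real.log n)
    (hm : (1 : ℝ) ≤ (1 - 1 / (2 * G * C)) ^ m * (C * (n ^ k : ℕ))) :
    m + 1 ≤ ⌊c * Real.log n⌋₊ := by
  have hGC : (0 : ℝ) < 2 * G * C := by positivity
  have hGC1 : (1 : ℝ) ≤ 2 * G * C := by
    have h1 : (1 : ℝ) ≤ G := by exact_mod_cast hG
    have h2 : (1 : ℝ) ≤ C := by exact_mod_cast hC
    nlinarith
  have hn0 : (0 : ℝ) < n := by exact_mod_cast hn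
  have hC0 : (0 : ℝ) < C := by exact_mod_cast hC
  have h0 : (0 : ℝ) ≤ 1 - 1 / (2 * G * C) := by
    rw [sub_nonneg, div_le_one hGC]; exact hGC1
  -- This is `1 - x ≤ exp (-x)`; taking logarithms then bounds `m` by `2 G C (log C + k log n)`.
  have h1 : (1 - 1 / (2 * G * C) : ℝ) ^ m ≤ Real.exp (-(1 / (2 * G * C)) * m) := by
    rw [mul_comm _ (m : ℝ), Real.exp_nat_mul]
    gcongr
    have := Real.add_one_le_exp (-(1 / (2 * G * C) : ℝ))
    linarith
  have h2 : (1 : ℝ) ≤ Real.exp (-(1 / (2 * G * C)) * m) * (C * n ^ k) := by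
    refine hm.trans ?_
    push_cast
    gcongr
  have h3 := Real.log_le_log one_pos h2
  rw [Real.log_one, Real.log_mul (Real.exp_pos _).ne' (by positivity), Real.log_exp,
    Real.log_mul hC0.ne' (by positivity), Real.log_pow] at h3
  have h4 : (m : ℝ) ≤ 2 * G * C * (Real.log C + k * Real.log n) := by
    have h5 := mul_le_mul_of_nonneg_left h3 hGC.le
    have h6 : 2 * G * C * (-(1 / (2 * G * C)) * m) = -(m : ℝ) := by field_simp
    rw [mul_zero, mul_add, h6] at h5
    linarith
  have hl : 0 ≤ Real.log n := Real.log_natCast_nonneg n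
  apply Nat.le_floor
  push_cast
  -- The extra `1` in `hc` contributes one `log n`, which by `hlog` covers the constant `2 G C log
  -- C` and the `+ 1`.
  nlinarith [mul_le_mul_of_nonneg_right hc hl]

open Filter in
theorem eventually_adequate (G C k s : ℕ) (c μ γ : ℝ) (hμ : 0 < μ) (hγ : 0 < γ) (hk : 0 < k)
    (hs : 0 < s) : ∃ n₀ : ℕ, ∀ n : ℕ, n₀ ≤ n → 2 ≤ n ∧ 2 * G ≤ n ∧ C ≤ n ∧ s ≤ n ∧
      (k : ℝ) * n ^ (k - 1) ≤ μ / 2 * n ^ k ∧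
      ((s * s + s * k : ℕ) : ℝ) * n ^ (s - 1) ≤ γ * n ^ s ∧
      1 + 2 * G * C * Real.log C ≤ Real.log n ∧
      2 * G * (s * s) * ⌊c * Real.log n⌋₊ ≤ n ∧ ⌊c * Real.log n⌋₊ < n := by
  rw [← eventually_atTop]
  have hlog : Tendsto (fun n : ℕ => Real.log n) atTop atTop :=
    Real.tendsto_log_atTop.comp tendsto_natCast_atTop_atTop
  have hpow : ∀ (a b : ℝ) (N : ℕ), 0 < b → 0 < N →
      ∀ᶠ n : ℕ in atTop, a * (n : ℝ) ^ (N - 1) ≤ b * n ^ N := by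
    intro a b N hb hN
    filter_upwards [tendsto_natCast_atTop_atTop.eventually_ge_atTop (a / b)] with n hn
    rw [div_le_iff₀' hb] at hn
    obtain ⟨N, rfl⟩ : ∃ N', N = N' + 1 := ⟨N - 1, by omega⟩
    rw [Nat.add_sub_cancel, pow_succ, mul_comm _ (n : ℝ), ← mul_assoc]
    gcongr
  have hsmall : ∀ A : ℕ, ∀ᶠ n : ℕ in atTop, A * ⌊c * Real.log n⌋₊ ≤ n := by
    intro A
    have h1 : (fun x : ℝ => (A * c) * Real.log x) =o[atTop] (fun x : ℝ => x) :=
      Real.isLittleO_log_id_atTop.const_mul_left _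
    have h2 := tendsto_natCast_atTop_atTop (R := ℝ) |>.eventually (h1.bound one_pos)
    filter_upwards [h2] with n hn
    rcases le_or_gt 0 (c * Real.log n) with h | h
    · rw [Real.norm_natCast, one_mul] at hn
      have h3 := (le_abs_self _).trans hn
      have h4 := mul_le_mul_of_nonneg_left (Nat.floor_le h) (Nat.cast_nonneg (α := ℝ) A)
      have h5 : ((A * ⌊c * Real.log n⌋₊ : ℕ) : ℝ) ≤ n := by
        push_cast
        linarith
      exact_mod_cast h5
    · rw [Nat.floor_of_nonpos h.le, mul_zero]
      exact Nat.zero_le _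
  filter_upwards [eventually_ge_atTop (2 + 2 * G + C + s), hpow k (μ / 2) k (by positivity) hk,
    hpow ((s * s + s * k : ℕ) : ℝ) γ s hγ hs, hlog.eventually_ge_atTop _,
    hsmall (2 * G * (s * s)), hsmall 2] with n h1 h2 h3 h4 h5 h6
  -- The last bound is `hsmall 2`: twice the floor is at most `n`, which is positive.
  exact ⟨by omega, by omega, by omega, by omega, h2, h3, h4, h5, by omega⟩

/-! ### The absorbing lemma. -/

open Classical in
theorem lemma4p2 (k t : ℕ) (hk : 2 ≤ k) (ht : 1 ≤ t) :
    -- the implied constant of the running time depends on `k` and `t` only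
    ∃ K : ℝ, 0 < K ∧
    ∀ C' : ℝ, 0 < C' →
    ∃ ε₀ : ℝ, 0 < ε₀ ∧ ∀ β μ : ℝ, 0 < β → β < ε₀ → 0 < μ → μ < ε₀ →
    ∃ c₀ : ℝ, 0 < c₀ ∧ ∀ c' : ℝ, c₀ < c' →
    -- a single program for all inputs, on words of `w ≥ q log₂ n` bits
    ∃ (A : WordRAM.Cmd) (q n₀ : ℕ), ∀ n : ℕ, n₀ ≤ n →
    ∀ (H : KGraph k (Fin n)) (d : ℕ) (p : Fin n → Fin d), Function.Surjective p →
    (∀ j : Fin d, H.ClosedIn β t (KGraph.part p j)) →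
    ∀ w : ℕ, n ^ q ≤ 2 ^ w →
    ∃ (s : WordRAM.State) (T : ℕ) (F : Finset (Finset (Fin n))),
      WordRAM.Exec w A (WordRAM.initState (WordRAM.encode H p)) s T ∧
      (T : ℝ) ≤ K * (n : ℝ) ^ (4 * t * k ^ 2) ∧
      WordRAM.Outputs (t * k ^ 2) s.mem F ∧
      (F.card : ℝ) ≤ c' * Real.log n ∧
      (F : Set (Finset (Fin n))).PairwiseDisjoint id ∧
      (∀ X ∈ F, X.card = t * k ^ 2 ∧ H.HasPerfectMatchingOn X) ∧
      ∀ S : Finset (Fin n), S.card = k →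
        KGraph.indexVector p S ∈ H.robustVectors p μ →
        C' ≤ ((F.filter (fun X => H.Absorbs X S)).card : ℝ) := by
  have hs : t * k ^ 2 = t * k * k := by ring
  have hs4 : 4 * t * k ^ 2 = 4 * (t * k * k) := by ring
  have hk0 : 0 < k := by omega
  have hs0 : 0 < t * k * k := by positivity
  rw [hs, hs4]
  refine ⟨WordRAM.runningConstant k t, by unfold WordRAM.runningConstant; positivity,
    fun C' hC' => ⟨1, one_pos, fun β μ hβ _ hμ _ => ?_⟩⟩
  -- The guaranteed proportion of absorbing tuples; `G ≥ 1 / γ` makes every tuple with a robust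
  -- index vector rich.
  set γ := μ * β ^ k / 4 with hγdef
  have hγ : 0 < γ := by positivity
  set G := ⌈1 / γ⌉₊ with hGdef
  have hG : 0 < G := Nat.ceil_pos.2 (by positivity)
  set C := ⌈C'⌉₊ with hCdef
  have hC : 0 < C := Nat.ceil_pos.2 hC'
  -- The initial deficit is at most `C n ^ k`, which needs about `2 G C k log n` rounds; the `+ 1`
  -- absorbs the lower-order terms.
  refine ⟨2 * G * C * k + 1, by positivity, fun c' hc' => ?_⟩
  obtain ⟨n₀, hn₀⟩ := eventually_adequate G C k (t * k * k) c' μ γ hμ hγ hk0 hs0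
  -- The exponent exceeds the one in `Adequate` by one, to make the word bound strict.
  refine ⟨WordRAM.absorbingProgram k t G C, t * k * k + k + 4, n₀,
    fun n hn H d p _ hcl w hw => ?_⟩
  obtain ⟨h2, h2G, hCn, hsn, hpk, hps, hlog, hM, hMn⟩ := hn₀ n hn
  have : NeZero n := ⟨by omega⟩
  have had : WordRAM.Expr.Adequate k t G C n w :=
    ⟨h2, h2G, hCn, hsn, (Nat.pow_lt_pow_right (by omega) (Nat.lt_succ_self _)).trans_le hw⟩
  obtain ⟨m, hmM, hzero, hmem, hdisj, hhits⟩ := Greedy.run_spec (n := n) (NX := n ^ (t * k * k))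
    (NY := n ^ k) (G := G) (C := C) (Ab := WordRAM.AbsorbsCode t H)
    (Dj := WordRAM.DisjointCodes n (t * k * k)) (by positivity) hG hC
    (fun X _ => card_not_disjointCodes_le n hs0 X) hM hMn
    (fun m hm => rounds_le hG hC (by omega) hc'.le hlog hm)
  set c := Greedy.run n (n ^ (t * k * k)) (n ^ k) G C (WordRAM.AbsorbsCode t H)
    (WordRAM.DisjointCodes n (t * k * k)) n with hcdef
  obtain ⟨s, T, hexec, hT, hout0, hout⟩ := WordRAM.exec_absorbingProgram had hk ht H p hcdef.symm
  set B : ℕ → Finset (Fin n) := fun i => univ.image (WordRAM.tuple n (t * k * k) (c i - 1)) with hB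
  have hcount : {i ∈ range n | 0 < c i} = range m := by
    ext i
    simp only [mem_filter, mem_range]
    constructor
    · rintro ⟨_, h⟩
      by_contra hi
      rw [hzero i (by omega)] at h
      omega
    · exact fun h => ⟨by omega, (hmem i h).1⟩
  rw [hcount, card_range] at hout0
  have hBspec : ∀ i < m, #(B i) = t * k * k ∧ H.HasPerfectMatchingOn (B i) := by
    intro i hi
    -- A chosen tuple had positive gain, so it absorbs some `Y`; hence its entries are distinct and
    -- its vertex set is matchable.
    obtain ⟨_, _, Y, _, hinj, hpm, _⟩ := hmem i hi
    refine ⟨?_, hpm⟩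
    rw [hB, card_image_of_injective _ fun a b hab => by simpa using @hinj (.inl a) (.inl b) hab,
      card_univ, Fintype.card_fin]
  have hBdisj : ∀ i < m, ∀ j < m, i ≠ j → Disjoint (B i) (B j) := by
    have key : ∀ j < m, ∀ i < j, Disjoint (B i) (B j) := by
      intro j hj i hi
      rw [disjoint_left]
      simp only [hB, mem_image, mem_univ, true_and]
      rintro _ ⟨a, rfl⟩ ⟨b, hb⟩
      exact hdisj j hj i hi a b hb.symm
    intro i hi j hj hij
    rcases lt_or_gt_of_ne hij with h | h
    · exact key j hj i h
    · exact (key i hi j h).symm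
  -- Disjoint nonempty sets are distinct, so hits counted by index are hits counted by members of
  -- the family.
  have hBinj : Set.InjOn B (range m) := by
    intro i hi j hj hij
    by_contra hne
    have hi' : i < m := by simpa using hi
    have hj' : j < m := by simpa using hj
    have := hBdisj i hi' j hj' hne
    rw [← hij, disjoint_self, bot_eq_empty] at this
    have h1 := (hBspec i hi').1
    rw [this, card_empty] at h1
    omega
  have hFcard : #((range m).image B) = m := by rw [card_image_of_injOn hBinj, card_range]
  refine ⟨s, T, (range m).image B, hexec, by exact_mod_cast hT, ⟨?_, ?_⟩, ?_, ?_, ?_, ?_⟩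
  · rw [hout0, hFcard]
  · rw [hout0]
    refine image_congr fun i hi => ?_
    have hi : i < m := by simpa using hi
    ext v
    simp only [WordRAM.block, hB, mem_filter, mem_image, mem_univ, true_and]
    constructor
    · rintro ⟨j, hj, hv⟩
      exact ⟨⟨j, hj⟩, Fin.ext ((hout i (by omega) ⟨j, hj⟩).symm.trans hv)⟩
    · rintro ⟨j, rfl⟩
      exact ⟨j, j.is_lt, hout i (by omega) j⟩
  · rw [hFcard]
    have hl : 0 ≤ c' * Real.log n := mul_nonneg
      ((by positivity : (0 : ℝ) ≤ 2 * G * C * k + 1).trans hc'.le) (Real.log_natCast_nonneg n)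
    exact ((Nat.cast_le (α := ℝ)).2 hmM).trans (Nat.floor_le hl)
  · intro X hX Y hY hXY
    simp only [coe_image, Set.mem_image, mem_coe, mem_range] at hX hY
    obtain ⟨i, hi, rfl⟩ := hX
    obtain ⟨j, hj, rfl⟩ := hY
    exact hBdisj i hi j hj fun h => hXY (by rw [h])
  · intro X hX
    obtain ⟨i, hi, rfl⟩ := mem_image.1 hX
    exact hBspec i (mem_range.1 hi)
  · intro S hS hrob
    set y : Fin k → Fin n := fun j => (S.equivFinOfCardEq hS).symm j with hy
    have hyinj : Function.Injective y := fun a b hab =>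
      (S.equivFinOfCardEq hS).symm.injective (Subtype.ext hab)
    have hyS : univ.image y = S := by
      ext v
      simp only [mem_image, mem_univ, true_and]
      exact ⟨by rintro ⟨i, rfl⟩; exact ((S.equivFinOfCardEq hS).symm i).2,
        fun hv => ⟨S.equivFinOfCardEq hS ⟨v, hv⟩, by simp [hy]⟩⟩
    obtain ⟨Y, hYlt, hY⟩ := WordRAM.exists_code n y
    have hrich : Greedy.Rich (n ^ (t * k * k)) G (WordRAM.AbsorbsCode t H) Y := by
      have h1 := KGraph.card_absorbsTuple H p hβ hcl y hyinj (hyS.symm ▸ hrob) (s := t * k * k)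
        (by
          obtain ⟨N, hN⟩ : ∃ N, t * k = N + 1 := ⟨t * k - 1, by
            have : 0 < t * k := by positivity
            omega⟩
          rw [hN, Nat.add_sub_cancel]; ring)
        (by rw [Fintype.card_fin]; exact hpk) (by rw [Fintype.card_fin]; exact hps)
      rw [Fintype.card_fin, ← WordRAM.card_codes n (t * k * k) (fun x => H.AbsorbsTuple x y),
        ← hY] at h1
      unfold Greedy.Rich
      have h3 : (1 : ℝ) ≤ G * γ := by
        have := Nat.le_ceil (1 / γ)
        rwa [div_le_iff₀ hγ] at this
      have h4 : (n ^ (t * k * k) : ℝ) ≤ G * #{X ∈ range (n ^ (t * k * k)) |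
          WordRAM.AbsorbsCode t H X Y} := by
        calc (n ^ (t * k * k) : ℝ) = 1 * n ^ (t * k * k) := (one_mul _).symm
          _ ≤ G * γ * n ^ (t * k * k) := by gcongr
          _ = G * (γ * n ^ (t * k * k)) := by ring
          _ ≤ _ := mul_le_mul_of_nonneg_left h1 (Nat.cast_nonneg _)
      exact_mod_cast h4
    have h5 := hhits Y hYlt hrich
    have h6 : Greedy.hits n (WordRAM.AbsorbsCode t H) c Y ≤
        #(((range m).image B).filter fun X => H.Absorbs X S) := by
      unfold Greedy.hits
      have hsub : ∀ i ∈ {i ∈ range n | 0 < c i ∧ WordRAM.AbsorbsCode t H (c i - 1) Y}, i < m ∧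
          WordRAM.AbsorbsCode t H (c i - 1) Y := fun i hi => by
        obtain ⟨h7, h8, h9⟩ := mem_filter.1 hi
        refine ⟨mem_range.1 (hcount ▸ mem_filter.2 ⟨h7, h8⟩), h9⟩
      refine card_le_card_of_injOn B (fun i hi => ?_) fun i hi j hj hij => ?_
      · obtain ⟨h7, _, h8, h9⟩ := hsub i hi
        rw [hY, hyS] at h9
        exact mem_filter.2 ⟨mem_image_of_mem _ (mem_range.2 h7), h8, h9⟩
      · exact hBinj (by simpa using (hsub i hi).1) (by simpa using (hsub j hj).1) hij
    exact (Nat.le_ceil C').trans (by exact_mod_cast h5.trans h6)
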